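/- **Unisolvence of the degrees of freedom for 2-forms on the tetrahedral prism.** Let $k\ge 1$ be an integer. *Element.* Let $T^3=\{x\in[-1,1]^3: x_1+x_2+x_3\le -1\}$ be the tetrahedron with vertices $v_1=(1,-1,-1)$, $v_2=(-1,1,-1)$, $v_3=(-1,-1,1)$, $v_4=(-1,-1,-1)$ and barycentric coordinates $\lambda_1,\dots,\lambda_4$; let $T^1=[-1,1]$ and $W^4=T^3\times T^1\subset\mathbb R^4$. $P^d$ denotes the polynomials of total degree $\le d$ ($P^d=\{0\}$ for $d<0$), and for polynomial spaces $A,B$ in separate variables $A\times B$ is the span of the products $a\,b$; $Q^{d,d}=P^d\times P^d$ on a rectangle. For $w\in\mathbb R^6$ let $\mathcal L(w)$ be the skew-symmetric $4\times4$ matrix with upper entries $(w_{12},w_{13},w_{14},w_{23},w_{24},w_{34})=w$, and for $u\in\mathbb R^3$ put $\mathcal A(u)=\mathcal L(0,0,u_1,0,u_2,u_3)$ and $\mathcal B(u)=\mathcal L(u_3,-u_2,0,u_1,0,0)$. *Space.* With $N^{k-1}(T^3)=(P^{k-1})^3+x\times(P^{k-1})^3$ and $RT^{k-1}(T^3)=(P^{k-1})^3+x\,P^{k-1}$,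 where $x=(x_1,x_2,x_3)$, let $$V_k\Lambda^2(W^4)=\operatorname{span}\{p(x_4)\,\mathcal A(u): p\in P^{k-1},\,u\in N^{k-1}(T^3)\}\oplus\operatorname{span}\{p(x_4)\,\mathcal B(u): p\in P^{k},\,u\in RT^{k-1}(T^3)\}.$$ *Trace.* For a facet $\mathcal F$ of $W^4$ with unit normal $n$ and a skew-symmetric matrix field $F$ let $\operatorname{Tr}(F)=(n\times F)|_{\mathcal F}$, $[n\times F]_i=\sum_{j,k,l}\varepsilon_{ijkl}n_jF_{kl}$, a vector field tangent to $\mathcal F$. *Degrees of freedom of $F$.* 1. For each of the 8 triangular faces $f$ (a face of $T^3$ at $x_4=\pm1$): $\int_f(\operatorname{Tr}(F)\cdot\nu)\,q$ for $q\in P^{k-1}(f)$. Here and in 2, the trace is taken on a facet containing $f$ (the tetrahedral one in 1, a triangular-prismatic one in 2), and $\nu$ is a unit normal of $f$ inside that facet (up to sign, the choice does not matter). 2. For each of the 6 quadrilateral faces $f$ (an edge of $T^3$ times $T^1$): $\int_f(\operatorname{Tr}(F)\cdot\nu)\,q$ for $q\in Q^{k-1,k-1}(f)$. 3. For each of the 2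 tetrahedral facets $\mathcal F$: $\int_{\mathcal F}\operatorname{Tr}(F)\cdot q$ for $q\in(P^{k-2}(\mathcal F))^3$, a tangent vector field. 4. For each of the 4 triangular-prismatic facets $\mathcal F=T^2\times T^1$ ($T^2$ a face of $T^3$): $\int_{\mathcal F}\operatorname{Tr}(F)\cdot q$, first for the fields $q$ tangent to $T^2$ with components in $P^{k-1}(T^1)\times P^{k-2}(T^2)$, and second for $q=q_3e_4$ with $q_3\in P^{k-2}(T^1)\times P^{k-1}(T^2)$. 5. $\int_{W^4}F:\mathcal A\big(\sum_{r=1}^3 q^r\,\lambda_c\lambda_d(\lambda_a\nabla\lambda_b-\lambda_b\nabla\lambda_a)\big)$ for $q^1,q^2,q^3\in P^{k-1}(T^1)\times P^{k-3}(T^3)$. 6. $\int_{W^4}F:\mathcal B\big(\sum_{r=1}^3 q^r\,\tfrac{(1-x_4)(1+x_4)}4\,\lambda_d(\lambda_a\nabla\lambda_b\times\nabla\lambda_c+\lambda_b\nabla\lambda_c\times\nabla\lambda_a+\lambda_c\nabla\lambda_a\times\nabla\lambda_b)\big)$ for $q^1,q^2,q^3\in P^{k-2}(T^1)\times P^{k-2}(T^3)$.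 In 5 and 6, $(a,b,c,d)=(1,2,3,4),(2,3,4,1),(3,4,1,2)$ for $r=1,2,3$, and $A:B=\sum_{i,j}A_{ij}B_{ij}$. *Claim.* These degrees of freedom are unisolvent on $V_k\Lambda^2(W^4)$: if $F\in V_k\Lambda^2(W^4)$ and all of them vanish, then $F\equiv0$; moreover, for every prescription of their values (one linear functional on the test space of each face in 1–2, each facet in 3, each of the two families on each facet in 4, and each of the volume families 5–6) there is exactly one $F\in V_k\Lambda^2(W^4)$ that attains it. -/

import Mathlib

namespace TetPrism

open MvPolynomial

noncomputable section

/-! ### Polynomial spaces -/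

/-- Real polynomials in `n` variables. -/
abbrev Poly (n : ℕ) : Type := MvPolynomial (Fin n) ℝ

/-- `P^d` in `n` variables: polynomials of total degree at most `d`; it is `{0}` when `d < 0`. -/
def P (n : ℕ) (d : ℤ) : Submodule ℝ (Poly n) :=
  restrictSupport ℝ {m | (m.degree : ℤ) ≤ d}

/-- A polynomial of the last variable only. -/
def liftLast {m : ℕ} (p : Poly 1) : Poly (m + 1) := rename (fun _ => Fin.last m) p

/-- A polynomial of the first `m` variables only. -/
def liftInit {m : ℕ} (u : Poly m) : Poly (m + 1) := rename Fin.castSucc u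

/-- The product `p(x_{m+1}) u(x_1, …, x_m)`. -/
def tmul {m : ℕ} (p : Poly 1) (u : Poly m) : Poly (m + 1) := liftLast p * liftInit u

/-- The tensor product `A × B` of a space of polynomials on a segment (last variable) and a
space of polynomials of the first `m` variables. -/
def tensor {m : ℕ} (A : Submodule ℝ (Poly 1)) (B : Submodule ℝ (Poly m)) :
    Submodule ℝ (Poly (m + 1)) :=
  Submodule.span ℝ (Set.image2 tmul (A : Set (Poly 1)) (B : Set (Poly m)))

/-- `(P^d)^3` on the tetrahedron. -/
def vecP (d : ℤ) : Submodule ℝ (Fin 3 → Poly 3) := Submodule.pi Set.univ fun _ => P 3 d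

/-- The coordinate vector field `x = (x_1, x_2, x_3)`. -/
def pos : Fin 3 → Poly 3 := fun i => X i

/-- First-kind Nédélec space `N^d = (P^d)^3 + x × (P^d)^3` on the tetrahedron. -/
def nedelec (d : ℤ) : Submodule ℝ (Fin 3 → Poly 3) :=
  vecP d ⊔ (vecP d).map ((crossProduct pos).restrictScalars ℝ)

/-- Raviart–Thomas space `RT^d = (P^d)^3 + x P^d` on the tetrahedron. -/
def raviartThomas (d : ℤ) : Submodule ℝ (Fin 3 → Poly 3) :=
  vecP d ⊔ (P 3 d).map ((LinearMap.toSpanSingleton (Poly 3) (Fin 3 → Poly 3) pos).restrictScalars ℝ)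

/-! ### Proxies of 2-forms -/

/-- The skew-symmetric matrix with upper entries `(w_12, w_13, w_14, w_23, w_24, w_34)`. -/
def skew {R : Type*} [CommRing R] (w : Fin 6 → R) : Matrix (Fin 4) (Fin 4) R :=
  !![0, w 0, w 1, w 2;
     -w 0, 0, w 3, w 4;
     -w 1, -w 3, 0, w 5;
     -w 2, -w 4, -w 5, 0]

/-- The matrix with the vector `u` in its fourth column (1-form in space, wedge `dx^4`). -/
def skewN {R : Type*} [CommRing R] (u : Fin 3 → R) : Matrix (Fin 4) (Fin 4) R :=
  skew ![0, 0, u 0, 0, u 1, u 2]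

/-- The matrix with upper entries `(u_3, -u_2, 0, u_1, 0, 0)` (2-form in space). -/
def skewRT {R : Type*} [CommRing R] (u : Fin 3 → R) : Matrix (Fin 4) (Fin 4) R :=
  skew ![u 2, -u 1, 0, u 0, 0, 0]

/-- Matrix fields on `ℝ⁴` with polynomial entries. -/
abbrev Field2 : Type := Matrix (Fin 4) (Fin 4) (Poly 4)

/-- `V_k Λ²(W⁴) = (DG^{k-1}(T¹) × N^{k-1}(T³)) ⊕ (CG^k(T¹) × RT^{k-1}(T³))`. On a single element
`DG^d` and `CG^d` are both the space of polynomials of degree at most `d`. -/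
def V2 (k : ℕ) : Submodule ℝ Field2 :=
  Submodule.span ℝ (Set.image2 (fun (p : Poly 1) (u : Fin 3 → Poly 3) => skewN fun i => tmul p (u i))
      (P 1 (k - 1) : Set (Poly 1)) (nedelec (k - 1) : Set (Fin 3 → Poly 3)))
  ⊔ Submodule.span ℝ
      (Set.image2 (fun (p : Poly 1) (u : Fin 3 → Poly 3) => skewRT fun i => tmul p (u i))
      (P 1 k : Set (Poly 1)) (raviartThomas (k - 1) : Set (Fin 3 → Poly 3)))

/-- The value of a matrix field at a point. -/
def at4 (F : Field2) (x : Fin 4 → ℝ) : Matrix (Fin 4) (Fin 4) ℝ := F.map (eval x)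

/-- The double contraction `A : B`. -/
def contract {R : Type*} [CommRing R] (A B : Matrix (Fin 4) (Fin 4) R) : R :=
  ∑ i, ∑ j, A i j * B i j

/-- The Levi-Civita symbol in dimension four. -/
def leviCivita (i j k l : Fin 4) : ℝ :=
  Matrix.det (Matrix.of fun a b : Fin 4 => if ![i, j, k, l] a = b then (1 : ℝ) else 0)

/-- `[n × U]_i = ∑ ε_{ijkl} n_j U_{kl}`. -/
def cross4 (n : Fin 4 → ℝ) (U : Matrix (Fin 4) (Fin 4) ℝ) : Fin 4 → ℝ := fun i =>
  ∑ j, ∑ k, ∑ l, leviCivita i j k l * n j * U k l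

/-! ### The reference tetrahedral prism, its faces and facets -/

/-- The reference tetrahedron. -/
def T3 : Set (Fin 3 → ℝ) := {x | (∀ i, -1 ≤ x i ∧ x i ≤ 1) ∧ x 0 + x 1 + x 2 ≤ -1}

/-- The reference tetrahedral prism. -/
def W4 : Set (Fin 4 → ℝ) := {x | (∀ i, -1 ≤ x i ∧ x i ≤ 1) ∧ x 0 + x 1 + x 2 ≤ -1}

/-- Vertices of the reference tetrahedron. -/
def vtx : Fin 4 → Fin 3 → ℝ := ![![1, -1, -1], ![-1, 1, -1], ![-1, -1, 1], ![-1, -1, -1]]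

/-- Barycentric coordinates of the reference tetrahedron. -/
def lam : Fin 4 → Poly 3 :=
  ![C (1 / 2) * (X 0 + 1), C (1 / 2) * (X 1 + 1), C (1 / 2) * (X 2 + 1),
    -(C (1 / 2) * (X 0 + X 1 + X 2 + 1))]

/-- Gradient of a polynomial of three variables. -/
def grad (p : Poly 3) : Fin 3 → Poly 3 := fun j => pderiv j p

/-- The point `(v, t)` of `ℝ⁴`. -/
def join (v : Fin 3 → ℝ) (t : ℝ) : Fin 4 → ℝ := ![v 0, v 1, v 2, t]

/-- The two ends of the segment `T¹ = [-1, 1]`. -/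
def height : Fin 2 → ℝ := ![-1, 1]

/-- Normalisation of a vector to Euclidean length one. -/
def unit {m : ℕ} (v : Fin m → ℝ) : Fin m → ℝ := (Real.sqrt (v ⬝ᵥ v))⁻¹ • v

/-- The outward unit normal, in `ℝ³`, of the face of the tetrahedron opposite to vertex `i`. -/
def normal3 (i : Fin 4) : Fin 3 → ℝ := unit fun j => -eval 0 (grad (lam i) j)

/-- The affine parametrisation with origin `o` and tangent vectors `t`. -/
def aff {m : ℕ} (o : Fin 4 → ℝ) (t : Fin m → Fin 4 → ℝ) (y : Fin m → ℝ) : Fin 4 → ℝ :=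
  o + ∑ a, y a • t a

/-- The surface integral, over the flat `m`-dimensional piece with tangent vectors `t` and
parameter domain `D`, of a function written in the parameters. -/
def surfInt {m : ℕ} (t : Fin m → Fin 4 → ℝ) (D : Set (Fin m → ℝ)) (g : (Fin m → ℝ) → ℝ) : ℝ :=
  Real.sqrt (Matrix.det (Matrix.of fun a b => t a ⬝ᵥ t b)) * ∫ y in D, g y

/-- The parameter triangle. -/
def triDom : Set (Fin 2 → ℝ) := {y | 0 ≤ y 0 ∧ 0 ≤ y 1 ∧ y 0 + y 1 ≤ 1}

/-- The parameter square. -/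
def quadDom : Set (Fin 2 → ℝ) := {y | 0 ≤ y 0 ∧ y 0 ≤ 1 ∧ 0 ≤ y 1 ∧ y 1 ≤ 1}

/-- The parameter triangular prism; its axis is the last variable. -/
def prismDom : Set (Fin 3 → ℝ) :=
  {y | 0 ≤ y 0 ∧ 0 ≤ y 1 ∧ y 0 + y 1 ≤ 1 ∧ 0 ≤ y 2 ∧ y 2 ≤ 1}

/-! #### Triangular faces: the face of `T³` opposite to vertex `i`, at the end `s` of `T¹` -/

def triOrigin (i : Fin 4) (s : Fin 2) : Fin 4 → ℝ := join (vtx (i.succAbove 0)) (height s)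

def triTangent (i : Fin 4) : Fin 2 → Fin 4 → ℝ :=
  ![join (vtx (i.succAbove 1) - vtx (i.succAbove 0)) 0,
    join (vtx (i.succAbove 2) - vtx (i.succAbove 0)) 0]

/-- `∫_f (Tr(F) · ν) q`: the trace is taken on the tetrahedral facet that contains the face,
and `ν` is the unit normal of the face in that facet. -/
def triMoment (F : Field2) (i : Fin 4) (s : Fin 2) (q : Poly 2) : ℝ :=
  surfInt (triTangent i) triDom fun y =>
    (cross4 ![0, 0, 0, height s] (at4 F (aff (triOrigin i s) (triTangent i) y))
      ⬝ᵥ join (normal3 i) 0) * eval y q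

/-! #### Quadrilateral faces: an edge of `T³` times `T¹` -/

/-- The six edges `{a, b}` of the tetrahedron, each followed by a vertex `c` off the edge. -/
def edge : Fin 6 → Fin 4 × Fin 4 × Fin 4 :=
  ![(0, 1, 2), (0, 2, 1), (0, 3, 1), (1, 2, 0), (1, 3, 0), (2, 3, 0)]

def quadOrigin (e : Fin 6) : Fin 4 → ℝ := join (vtx (edge e).1) (-1)

def quadTangent (e : Fin 6) : Fin 2 → Fin 4 → ℝ :=
  ![join (vtx (edge e).2.1 - vtx (edge e).1) 0, ![0, 0, 0, 2]]

/-- `∫_f (Tr(F) · ν) q`: the trace is taken on the triangular-prismatic facet opposite to `c`, and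
`ν` is the unit normal of the face in that facet. -/
def quadMoment (F : Field2) (e : Fin 6) (q : Poly 2) : ℝ :=
  surfInt (quadTangent e) quadDom fun y =>
    (cross4 (join (normal3 (edge e).2.2) 0) (at4 F (aff (quadOrigin e) (quadTangent e) y))
      ⬝ᵥ join (unit (crossProduct (normal3 (edge e).2.2)
        (vtx (edge e).2.1 - vtx (edge e).1))) 0) * eval y q

/-! #### Tetrahedral facets `T³ × {±1}` -/

def tetTangent : Fin 3 → Fin 4 → ℝ := ![![1, 0, 0, 0], ![0, 1, 0, 0], ![0, 0, 1, 0]]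

/-- `∫ Tr(F) · q` over a tetrahedral facet. -/
def tetMoment (F : Field2) (s : Fin 2) (q : Fin 3 → Poly 3) : ℝ :=
  surfInt tetTangent T3 fun y =>
    cross4 ![0, 0, 0, height s] (at4 F (aff ![0, 0, 0, height s] tetTangent y))
      ⬝ᵥ ∑ a, eval y (q a) • tetTangent a

/-! #### Triangular-prismatic facets: the face of `T³` opposite to vertex `i`, times `T¹` -/

def prismOrigin (i : Fin 4) : Fin 4 → ℝ := join (vtx (i.succAbove 0)) (-1)

/-- Two tangents of the triangle, then the axial tangent. -/
def prismTangent (i : Fin 4) : Fin 3 → Fin 4 → ℝ :=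
  ![join (vtx (i.succAbove 1) - vtx (i.succAbove 0)) 0,
    join (vtx (i.succAbove 2) - vtx (i.succAbove 0)) 0,
    ![0, 0, 0, 2]]

/-- `∫ Tr(F) · q` over a triangular-prismatic facet; `q` is given by its components on the
tangent vectors of the facet (the first two in the triangle, the third along the axis). -/
def prismMoment (F : Field2) (i : Fin 4) (q : Fin 3 → Poly 3) : ℝ :=
  surfInt (prismTangent i) prismDom fun y =>
    cross4 (join (normal3 i) 0) (at4 F (aff (prismOrigin i) (prismTangent i) y))
      ⬝ᵥ ∑ a, eval y (q a) • prismTangent i a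

/-! ### Weighted volume moments -/

/-- The cyclic labels `(a, b, c, d) = (r, r+1, r+2, r+3)` modulo four: `label r 0 = a`, etc. -/
def label (r : Fin 3) (j : Fin 4) : Fin 4 := r.castSucc + j

/-- `Φ^{b,r} N^r = λ_c λ_d (λ_a ∇λ_b - λ_b ∇λ_a)`. -/
def curlBubble (r : Fin 3) : Fin 3 → Poly 3 :=
  let a := label r 0; let b := label r 1; let c := label r 2; let d := label r 3
  (lam c * lam d) • (lam a • grad (lam b) - lam b • grad (lam a))

/-- `Ψ^{b,r} 𝒩^r = λ_d (λ_a ∇λ_b × ∇λ_c + λ_b ∇λ_c × ∇λ_a + λ_c ∇λ_a × ∇λ_b)`. -/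
def divBubble (r : Fin 3) : Fin 3 → Poly 3 :=
  let a := label r 0; let b := label r 1; let c := label r 2; let d := label r 3
  lam d • (lam a • crossProduct (grad (lam b)) (grad (lam c))
    + lam b • crossProduct (grad (lam c)) (grad (lam a))
    + lam c • crossProduct (grad (lam a)) (grad (lam b)))

/-- The bubble `ν_1 ν_2` of the segment `[-1, 1]`. -/
def segBubble : Poly 1 := (C (1 / 2) * (1 - X 0)) * (C (1 / 2) * (1 + X 0))

/-- First family of volume moments. -/
def volMoment1 (F : Field2) (q : Fin 3 → Poly 4) : ℝ :=
  ∫ x in W4, eval x (contract F (skewN fun j => ∑ r, q r * liftInit (curlBubble r j)))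

/-- Second family of volume moments. -/
def volMoment2 (F : Field2) (q : Fin 3 → Poly 4) : ℝ :=
  ∫ x in W4, eval x (contract F
    (skewRT fun j => ∑ r, q r * liftInit (divBubble r j) * liftLast segBubble))

/-! ### The degrees of freedom -/

/-- Prescribed values of all degrees of freedom of order `k`: one linear functional on the space of
test polynomials for each face, each facet family and each volume family. -/
structure DofValues (k : ℕ) where
  tri : Fin 4 → Fin 2 → Module.Dual ℝ (P 2 (k - 1))
  quad : Fin 6 → Module.Dual ℝ (tensor (P 1 (k - 1)) (P 1 (k - 1)))
  tet : Fin 2 → Module.Dual ℝ (Fin 3 → P 3 (k - 2))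
  prism1 : Fin 4 → Module.Dual ℝ (Fin 2 → tensor (P 1 (k - 1)) (P 2 (k - 2)))
  prism2 : Fin 4 → Module.Dual ℝ (tensor (P 1 (k - 2)) (P 2 (k - 1)))
  vol1 : Module.Dual ℝ (Fin 3 → tensor (P 1 (k - 1)) (P 3 (k - 3)))
  vol2 : Module.Dual ℝ (Fin 3 → tensor (P 1 (k - 2)) (P 3 (k - 2)))

/-- All degrees of freedom of `F` have the prescribed values `D`. -/
structure HasDofs (k : ℕ) (F : Field2) (D : DofValues k) : Prop where
  tri : ∀ i s (q : P 2 (k - 1)), triMoment F i s (q : Poly 2) = D.tri i s q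
  quad : ∀ e (q : tensor (P 1 (k - 1)) (P 1 (k - 1))), quadMoment F e (q : Poly 2) = D.quad e q
  tet : ∀ s (q : Fin 3 → P 3 (k - 2)), tetMoment F s (fun a => (q a : Poly 3)) = D.tet s q
  prism1 : ∀ i (q : Fin 2 → tensor (P 1 (k - 1)) (P 2 (k - 2))),
    prismMoment F i ![(q 0 : Poly 3), (q 1 : Poly 3), 0] = D.prism1 i q
  prism2 : ∀ i (q : tensor (P 1 (k - 2)) (P 2 (k - 1))),
    prismMoment F i ![0, 0, (q : Poly 3)] = D.prism2 i q
  vol1 : ∀ q : Fin 3 → tensor (P 1 (k - 1)) (P 3 (k - 3)),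
    volMoment1 F (fun r => (q r : Poly 4)) = D.vol1 q
  vol2 : ∀ q : Fin 3 → tensor (P 1 (k - 2)) (P 3 (k - 2)),
    volMoment2 F (fun r => (q r : Poly 4)) = D.vol2 q

/-- All degrees of freedom of `F` vanish. -/
def DofsVanish (k : ℕ) (F : Field2) : Prop := HasDofs k F ⟨0, 0, 0, 0, 0, 0, 0⟩

end

end TetPrism

namespace TetPrism

open MvPolynomial MeasureTheory

/-! ### Polynomials of bounded degree -/

/-! Write a field as F = 𝒜(E) + ℬ(H), with E of Nédélec and H of Raviart–Thomas type. Every degree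
of freedom reads only one of the two parts (`trace_horizontal`, `trace_axial`, `trace_lateral`,
`contract_field_skewN`, `contract_field_skewRT`), so E and H can be treated separately.

Injectivity rests on one device. A component known to vanish on lower-dimensional pieces is
divisible by the barycentric coordinates that vanish there. The cofactors, or their differences,
have low enough degree to serve as test functions, and the tested moment becomes the integral of a
sum of squares with nonnegative weights (`Region.eq_zero_of_sum_sq`). Linear independence of the
axial factors then turns ∑ p_j w_j = 0 into w_j = 0 for each j (`eq_zero_of_sum_tmul`).

For E (`nedelec_unisolvent`), the edge components lie in the test space and are tested with
themselves. On a face, the three edge cofactors agree in their excess degree, so their differences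
are admissible tests (`nedelec_face`). Once all tangential traces vanish, the coefficient fields are
combinations of the curl bubbles, with coefficients in the volume test space (`nedelec_bubble`).

For H, the values at the two ends of the segment vanish by the triangle and tetrahedron moments
(`raviartThomas_end`). What is left is a multiple of the segment bubble. The axial prism moments
remove its normal traces, and the div bubbles finish as before (`raviartThomas_bubble`,
`raviartThomas_interior`).

Existence is a dimension count. The space is the image of the coordinate space `Coeffs`, on which
the degrees of freedom are injective. A lower bound for its dimension and an upper bound for that of
the prescriptions force bijectivity. -/

/-- The alternative p = 0 matters only for negative d, because the total degree of 0 is 0. -/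
theorem mem_P_iff {n : ℕ} {d : ℤ} {p : Poly n} : p ∈ P n d ↔ p = 0 ∨ (p.totalDegree : ℤ) ≤ d := by
  simp only [P, mem_restrictSupport_iff, Set.subset_def, Finset.mem_coe, Set.mem_ofPred_eq]
  constructor
  · intro h
    rcases eq_or_ne p 0 with rfl | hp
    · exact Or.inl rfl
    · right
      obtain ⟨m, hm⟩ := support_nonempty.2 hp
      lift d to ℕ using (le_trans (by positivity) (h m hm))
      exact_mod_cast Finset.sup_le fun b hb => Nat.cast_le.1 (h b hb)
  · rintro (rfl | h) m hm
    · simp at hm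
    · have : m.degree ≤ p.totalDegree := le_totalDegree hm
      omega

theorem P_mono {n : ℕ} {a b : ℤ} (h : a ≤ b) : P n a ≤ P n b :=
  restrictSupport_mono ℝ fun _ hm => le_trans hm h

theorem P_eq_bot {n : ℕ} {d : ℤ} (h : d < 0) : P n d = ⊥ := by
  rw [eq_bot_iff]
  intro p hp
  rcases mem_P_iff.1 hp with rfl | hp
  · simp
  · omega

theorem mul_mem_P {n : ℕ} {a b : ℤ} {p q : Poly n} (hp : p ∈ P n a) (hq : q ∈ P n b) :
    p * q ∈ P n (a + b) := by
  rcases mem_P_iff.1 hp with rfl | hp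
  · simp
  rcases mem_P_iff.1 hq with rfl | hq
  · simp
  refine mem_P_iff.2 (Or.inr ?_)
  have := totalDegree_mul p q
  omega

theorem C_mem_P {n : ℕ} {d : ℤ} (hd : 0 ≤ d) (c : ℝ) : (C c : Poly n) ∈ P n d :=
  mem_P_iff.2 (Or.inr (by simpa using hd))

theorem C_mul_mem_P {n : ℕ} {d : ℤ} (c : ℝ) {p : Poly n} (hp : p ∈ P n d) : C c * p ∈ P n d := by
  rw [C_mul']; exact Submodule.smul_mem _ _ hp

theorem X_mem_P {n : ℕ} {d : ℤ} (hd : 1 ≤ d) (i : Fin n) : (X i : Poly n) ∈ P n d :=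
  mem_P_iff.2 (Or.inr (by simpa using hd))

/-- Division by a polynomial of positive degree lowers the degree. -/
theorem mem_P_of_mul_mem {n : ℕ} {d : ℤ} {l p : Poly n} (hl : 1 ≤ l.totalDegree)
    (h : l * p ∈ P n d) : p ∈ P n (d - 1) := by
  rcases eq_or_ne p 0 with rfl | hp
  · simp
  have hl0 : l ≠ 0 := by rintro rfl; simp at hl
  rcases mem_P_iff.1 h with h | h
  · simp [hl0, hp] at h
  · rw [totalDegree_mul_of_isDomain hl0 hp] at h
    refine mem_P_iff.2 (Or.inr ?_)
    push_cast at h; omega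

/-- Substitution of affine polynomials does not raise the degree. -/
theorem aeval_mem_P {m n : ℕ} {d : ℤ} {f : Fin m → Poly n} (hf : ∀ i, f i ∈ P n 1) {p : Poly m}
    (hp : p ∈ P m d) : aeval f p ∈ P n d := by
  have key : ∀ s : Fin m →₀ ℕ, (s.prod fun i e => f i ^ e) ∈ P n s.degree := by
    intro s
    refine mem_P_iff.2 (Or.inr (Nat.cast_le.2 ((totalDegree_finsetProd _ _).trans
      (Finset.sum_le_sum fun i _ => (totalDegree_pow _ _).trans ?_))))
    have : (f i).totalDegree ≤ 1 := by
      rcases mem_P_iff.1 (hf i) with h | h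
      · simp [h]
      · exact_mod_cast h
    simpa using Nat.mul_le_mul_left (s i) this
  revert p
  change P m d ≤ (P n d).comap (aeval f).toLinearMap
  rw [P, restrictSupport_eq_span, Submodule.span_le]
  rintro _ ⟨s, hs, rfl⟩
  simp only [SetLike.mem_coe, Submodule.mem_comap, AlgHom.toLinearMap_apply, aeval_monomial, map_one,
    one_mul]
  exact P_mono hs (key s)

/-- If `ψ ∘ φ` is the identity modulo `l`, the kernel of `φ` consists of multiples of `l`. -/
theorem dvd_of_map_eq_zero {m n : ℕ} (φ : Poly m →ₐ[ℝ] Poly n) (ψ : Poly n →ₐ[ℝ] Poly m) (l : Poly m)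
    (h : ∀ i, l ∣ X i - ψ (φ (X i))) {p : Poly m} (hp : φ p = 0) : l ∣ p := by
  have key : ∀ p : Poly m, l ∣ p - ψ (φ p) := by
    intro p
    induction p using MvPolynomial.induction_on with
    | C a => rw [← algebraMap_eq, AlgHom.commutes, AlgHom.commutes]; simp
    | add p q hp hq => rw [map_add, map_add, add_sub_add_comm]; exact dvd_add hp hq
    | mul_X p i hp =>
      rw [map_mul, map_mul]
      have : p * X i - ψ (φ p) * ψ (φ (X i)) =
        (p - ψ (φ p)) * X i + ψ (φ p) * (X i - ψ (φ (X i))) := by ring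
      rw [this]
      exact dvd_add (hp.mul_right _) ((h i).mul_left _)
  simpa [hp] using key p

/-! ### Integration of polynomials and positivity -/

/-- A compact region that contains a cube. -/
structure Region {n : ℕ} (D : Set (Fin n → ℝ)) : Prop where
  compact : IsCompact D
  cube : ∃ (c : Fin n → ℝ) (r : ℝ), 0 < r ∧ Metric.ball c r ⊆ D

section region
variable {n : ℕ} {D : Set (Fin n → ℝ)}

theorem Region.eq_zero_of_eval (hD : Region D) {p : Poly n} (h : ∀ y ∈ D, eval y p = 0) : p = 0 := by
  obtain ⟨c, r, hr, hc⟩ := hD.cube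
  refine funext_set (fun i => Metric.ball (c i) r) (fun i => ?_) fun x hx => ?_
  · rw [Real.ball_eq_Ioo]; exact Set.Ioo_infinite (by linarith)
  · rw [map_zero]; exact h x (hc (by rwa [ball_pi _ hr]))

theorem Region.integrableOn (hD : Region D) (p : Poly n) : IntegrableOn (fun y => eval y p) D :=
  (MvPolynomial.continuous_eval p).continuousOn.integrableOn_compact hD.compact

theorem Region.eq_zero_of_integral (hD : Region D) {p : Poly n} (h0 : ∀ y ∈ D, 0 ≤ eval y p)
    (h : ∫ y in D, eval y p = 0) : p = 0 := by
  obtain ⟨c, r, hr, hc⟩ := hD.cube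
  rw [setIntegral_eq_zero_iff_of_nonneg_ae
    ((ae_restrict_iff' hD.compact.measurableSet).2 (Filter.Eventually.of_forall h0))
    (hD.integrableOn p)] at h
  have h2 := Measure.eqOn_open_of_ae_eq (ae_restrict_of_ae_restrict_of_subset hc h)
    Metric.isOpen_ball (MvPolynomial.continuous_eval p).continuousOn continuousOn_const
  -- Vanishing is known on the open ball only; halving the radius gives a compact region inside it.
  have hB : Region (Metric.closedBall c (r / 2)) :=
    ⟨isCompact_closedBall _ _, c, r / 2, by positivity, Metric.ball_subset_closedBall⟩
  exact hB.eq_zero_of_eval fun y hy => h2 (Metric.closedBall_subset_ball (by linarith) hy)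

/-- The integral over a region as a linear functional on polynomials. -/
noncomputable def Region.integral (hD : Region D) : Poly n →ₗ[ℝ] ℝ where
  toFun p := ∫ y in D, eval y p
  map_add' p q := by
    simp only [map_add]; exact integral_add (hD.integrableOn p) (hD.integrableOn q)
  map_smul' c p := by
    simp only [smul_eval, RingHom.id_apply, smul_eq_mul]; exact integral_const_mul _ _

theorem Region.integral_apply (hD : Region D) (p : Poly n) :
    hD.integral p = ∫ y in D, eval y p := rfl

/-- A vanishing weighted sum of squares has vanishing terms. -/
theorem Region.eq_zero_of_sum_sq {ι : Type*} (s : Finset ι) (hD : Region D) (l w : ι → Poly n)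
    (hl : ∀ i ∈ s, ∀ y ∈ D, 0 ≤ eval y (l i)) (hl0 : ∀ i ∈ s, l i ≠ 0)
    (h : hD.integral (∑ i ∈ s, l i * (w i * w i)) = 0) : ∀ i ∈ s, w i = 0 := by
  have hpos : ∀ y ∈ D, ∀ i ∈ s, 0 ≤ eval y (l i * (w i * w i)) := fun y hy i hi => by
    rw [map_mul, map_mul]; exact mul_nonneg (hl i hi y hy) (mul_self_nonneg _)
  have h1 := hD.eq_zero_of_integral
    (fun y hy => by rw [map_sum]; exact Finset.sum_nonneg (hpos y hy)) h
  intro i hi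
  have h2 : l i * (w i * w i) = 0 := hD.eq_zero_of_eval fun y hy => by
    have := congrArg (eval y) h1
    rw [map_sum, map_zero, Finset.sum_eq_zero_iff_of_nonneg (hpos y hy)] at this
    exact this i hi
  simpa [hl0 i hi] using h2

end region

/-! ### Affine substitutions -/

theorem one_le_totalDegree {n : ℕ} {p : Poly n} (x y : Fin n → ℝ) (h : eval x p ≠ eval y p) :
    1 ≤ p.totalDegree := by
  by_contra hp
  rw [totalDegree_eq_zero_iff_eq_C.1 (by omega : p.totalDegree = 0)] at h
  simp at h

/-- Pullback of polynomials by `y ↦ o + ∑ a, y a • t a`. -/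
noncomputable def affHom {m n : ℕ} (o : Fin m → ℝ) (t : Fin n → Fin m → ℝ) : Poly m →ₐ[ℝ] Poly n :=
  aeval fun i => C (o i) + ∑ a, C (t a i) * X a

theorem affHom_X {m n : ℕ} (o : Fin m → ℝ) (t : Fin n → Fin m → ℝ) (i : Fin m) :
    affHom o t (X i) = C (o i) + ∑ a, C (t a i) * X a := aeval_X _ _

theorem affHom_C {m n : ℕ} (o : Fin m → ℝ) (t : Fin n → Fin m → ℝ) (c : ℝ) :
    affHom o t (C c) = C c := by rw [← algebraMap_eq, AlgHom.commutes]; rfl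

theorem eval_affHom {m n : ℕ} (o : Fin m → ℝ) (t : Fin n → Fin m → ℝ) (y : Fin n → ℝ) (p : Poly m) :
    eval y (affHom o t p) = eval (o + ∑ a, y a • t a) p := by
  have : (aeval y).comp (affHom o t) = aeval (R := ℝ) (o + ∑ a, y a • t a) := by
    refine algHom_ext fun i => ?_
    simp [affHom_X, mul_comm]
  simpa [aeval_eq_eval] using DFunLike.congr_fun this p

theorem affHom_mem_P {m n : ℕ} (o : Fin m → ℝ) (t : Fin n → Fin m → ℝ) {d : ℤ} {p : Poly m}
    (hp : p ∈ P m d) : affHom o t p ∈ P n d := by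
  refine aeval_mem_P (fun i => Submodule.add_mem _ (C_mem_P (by norm_num) _)
    (Submodule.sum_mem _ fun a _ => C_mul_mem_P _ (X_mem_P le_rfl a))) hp

/-- The product of a constant vector and a vector field. -/
noncomputable def dotC {n : ℕ} (a : Fin 3 → ℝ) : (Fin 3 → Poly n) →ₗ[ℝ] Poly n where
  toFun u := ∑ i, C (a i) * u i
  map_add' u v := by simp [mul_add, Finset.sum_add_distrib]
  map_smul' c u := by simp [Finset.smul_sum, C_mul', smul_comm c]

theorem dotC_apply {n : ℕ} (a : Fin 3 → ℝ) (u : Fin 3 → Poly n) : dotC a u = ∑ i, C (a i) * u i := rfl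

theorem dotC_mem_P {n : ℕ} (a : Fin 3 → ℝ) {d : ℤ} {u : Fin 3 → Poly n} (hu : ∀ i, u i ∈ P n d) :
    dotC a u ∈ P n d :=
  Submodule.sum_mem _ fun i _ => C_mul_mem_P _ (hu i)

/-! ### Faces and edges of the tetrahedron -/

/-- The constant gradients of the barycentric coordinates. -/
noncomputable def gradLam : Fin 4 → Fin 3 → ℝ :=
  ![![1 / 2, 0, 0], ![0, 1 / 2, 0], ![0, 0, 1 / 2], ![-(1 / 2), -(1 / 2), -(1 / 2)]]

theorem grad_lam (i : Fin 4) (j : Fin 3) : grad (lam i) j = C (gradLam i j) := by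
  fin_cases i <;> fin_cases j <;> simp [grad, lam, gradLam, pderiv_X]

theorem eval_lam_vtx (i j : Fin 4) : eval (vtx j) (lam i) = if i = j then 1 else 0 := by
  fin_cases i <;> fin_cases j <;> simp [lam, vtx] <;> norm_num

theorem sum_lam : lam 0 + lam 1 + lam 2 + lam 3 = 1 := by
  refine MvPolynomial.funext fun y => ?_
  simp [lam]
  ring

theorem lam_totalDegree (i : Fin 4) : 1 ≤ (lam i).totalDegree := by
  refine one_le_totalDegree (vtx i) (vtx (i + 1)) ?_
  rw [eval_lam_vtx, eval_lam_vtx, if_pos rfl, if_neg (by fin_cases i <;> decide)]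
  norm_num

theorem lam_ne_zero (i : Fin 4) : lam i ≠ 0 := by
  intro h; simpa [h] using lam_totalDegree i

/-- Tangent vectors of the face opposite to vertex `i`. -/
def faceTan (i : Fin 4) : Fin 2 → Fin 3 → ℝ :=
  ![vtx (i.succAbove 1) - vtx (i.succAbove 0), vtx (i.succAbove 2) - vtx (i.succAbove 0)]

/-- Restriction to the face opposite to vertex `i`. -/
noncomputable def faceHom (i : Fin 4) : Poly 3 →ₐ[ℝ] Poly 2 := affHom (vtx (i.succAbove 0)) (faceTan i)

/-- Restriction to the edge from vertex `a` to vertex `b`. -/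
noncomputable def edgeHom (a b : Fin 4) : Poly 3 →ₐ[ℝ] Poly 1 := affHom (vtx a) fun _ => vtx b - vtx a

theorem faceHom_lam (i : Fin 4) (m : Fin 3) :
    faceHom i (lam (i.succAbove m)) = ![1 - X 0 - X 1, X 0, X 1] m := by
  refine MvPolynomial.funext fun y => ?_
  rw [faceHom, eval_affHom]
  fin_cases i <;> fin_cases m <;>
    simp [lam, vtx, faceTan, Fin.succAbove, Fin.sum_univ_two, Fin.lt_def] <;> ring

theorem faceHom_lam_self (i : Fin 4) : faceHom i (lam i) = 0 := by
  refine MvPolynomial.funext fun y => ?_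
  rw [faceHom, eval_affHom]
  fin_cases i <;>
    simp [lam, vtx, faceTan, Fin.succAbove, Fin.sum_univ_two, Fin.lt_def]
  ring

theorem lam_dvd {i : Fin 4} {p : Poly 3} (h : faceHom i p = 0) : lam i ∣ p := by
  refine dvd_of_map_eq_zero (faceHom i) (aeval ![lam (i.succAbove 1), lam (i.succAbove 2)]) (lam i)
    -- The retraction onto the face moves x by λ_i times the edge vector from the base vertex of the
    -- face to vertex i.
    (fun j => ⟨C (vtx i j - vtx (i.succAbove 0) j), ?_⟩) h
  refine MvPolynomial.funext fun y => ?_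
  fin_cases i <;> fin_cases j <;>
    simp [faceHom, lam, affHom_X, vtx, faceTan, Fin.succAbove, Fin.sum_univ_two, Fin.lt_def] <;> ring

/-! Divisibility of polynomials that vanish on an edge of the reference triangle. -/

theorem X_one_dvd {p : Poly 2} (h : affHom ![0, 0] (fun _ => ![1, 0]) p = (0 : Poly 1)) : X 1 ∣ p := by
  refine dvd_of_map_eq_zero (affHom ![0, 0] fun _ => ![1, 0]) (aeval fun _ => X 0) (X 1) (fun j => ?_) h
  fin_cases j <;> simp [affHom_X]

theorem X_zero_dvd {p : Poly 2} (h : affHom ![0, 0] (fun _ => ![0, 1]) p = (0 : Poly 1)) : X 0 ∣ p := by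
  refine dvd_of_map_eq_zero (affHom ![0, 0] fun _ => ![0, 1]) (aeval fun _ => X 1) (X 0) (fun j => ?_) h
  fin_cases j <;> simp [affHom_X]

theorem diag_dvd {p : Poly 2} (h : affHom ![1, 0] (fun _ => ![-1, 1]) p = (0 : Poly 1)) :
    1 - X 0 - X 1 ∣ p := by
  refine dvd_of_map_eq_zero (affHom ![1, 0] fun _ => ![-1, 1]) (aeval fun _ => X 1) _ (fun j => ?_) h
  fin_cases j
  · exact ⟨-1, by simp [affHom_X]; ring⟩
  · simp [affHom_X]

theorem affHom_affHom {l m n : ℕ} (o : Fin l → ℝ) (t : Fin m → Fin l → ℝ) (o' : Fin m → ℝ)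
    (t' : Fin n → Fin m → ℝ) (o'' : Fin l → ℝ) (t'' : Fin n → Fin l → ℝ) (p : Poly l)
    (h : o + ∑ a, o' a • t a = o'') (h' : ∀ b, ∑ a, t' b a • t a = t'' b) :
    affHom o' t' (affHom o t p) = affHom o'' t'' p := by
  refine MvPolynomial.funext fun y => ?_
  rw [eval_affHom, eval_affHom, eval_affHom, ← h]
  congr 2
  ext i
  simp only [← h', Pi.add_apply, Finset.sum_apply, Pi.smul_apply, smul_eq_mul, Finset.mul_sum,
    Finset.sum_mul, add_mul, Finset.sum_add_distrib, add_assoc]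
  rw [Finset.sum_comm]
  simp only [mul_assoc]

/-! ### The Raviart–Thomas space -/

theorem mem_vecP {d : ℤ} {v : Fin 3 → Poly 3} : v ∈ vecP d ↔ ∀ i, v i ∈ P 3 d := by
  simp [vecP, Submodule.mem_pi]

theorem mem_raviartThomas {d : ℤ} {u : Fin 3 → Poly 3} :
    u ∈ raviartThomas d ↔ ∃ v : Fin 3 → Poly 3, (∀ i, v i ∈ P 3 d) ∧ ∃ s ∈ P 3 d, ∀ i, u i = v i + X i * s := by
  simp only [raviartThomas, Submodule.mem_sup, mem_vecP, Submodule.mem_map]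
  constructor
  · rintro ⟨v, hv, _, ⟨s, hs, rfl⟩, rfl⟩
    exact ⟨v, hv, s, hs, fun i => by simp [pos, mul_comm]⟩
  · rintro ⟨v, hv, s, hs, h⟩
    exact ⟨v, hv, _, ⟨s, hs, rfl⟩, funext fun i => by simp [pos, mul_comm, h]⟩

theorem mem_nedelec {d : ℤ} {u : Fin 3 → Poly 3} :
    u ∈ nedelec d ↔ ∃ v : Fin 3 → Poly 3, (∀ i, v i ∈ P 3 d) ∧ ∃ s : Fin 3 → Poly 3, (∀ i, s i ∈ P 3 d) ∧
      u = v + crossProduct X s := by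
  simp only [nedelec, Submodule.mem_sup, mem_vecP, Submodule.mem_map]
  constructor
  · rintro ⟨v, hv, _, ⟨s, hs, rfl⟩, rfl⟩
    exact ⟨v, hv, s, hs, rfl⟩
  · rintro ⟨v, hv, s, hs, rfl⟩
    exact ⟨v, hv, _, ⟨s, hs, rfl⟩, rfl⟩

theorem lam_eq (i : Fin 4) : ∃ c : ℝ, dotC (gradLam i) X = lam i + C c := by
  fin_cases i
  · exact ⟨-(1 / 2), by simp [dotC_apply, gradLam, lam, Fin.sum_univ_three]; ring⟩
  · exact ⟨-(1 / 2), by simp [dotC_apply, gradLam, lam, Fin.sum_univ_three]; ring⟩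
  · exact ⟨-(1 / 2), by simp [dotC_apply, gradLam, lam, Fin.sum_univ_three]; ring⟩
  · exact ⟨1 / 2, by simp [dotC_apply, gradLam, lam, Fin.sum_univ_three]; ring⟩

/-- Since ∇λ_i · x equals λ_i up to a constant, one polynomial s carries the excess degree of all
four normal components. -/
theorem raviartThomas_dotC {d : ℤ} {u : Fin 3 → Poly 3} (hu : u ∈ raviartThomas d) :
    ∃ s ∈ P 3 d, ∀ i, dotC (gradLam i) u - lam i * s ∈ P 3 d := by
  obtain ⟨v, hv, s, hs, h⟩ := mem_raviartThomas.1 hu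
  refine ⟨s, hs, fun i => ?_⟩
  obtain ⟨c, hc⟩ := lam_eq i
  have h1 : dotC (gradLam i) u = dotC (gradLam i) v + dotC (gradLam i) X * s := by
    simp only [dotC_apply, h, Fin.sum_univ_three]; ring
  have h2 : dotC (gradLam i) u - lam i * s = dotC (gradLam i) v + C c * s := by
    rw [h1, hc]; ring
  rw [h2]
  exact Submodule.add_mem _ (dotC_mem_P _ hv) (C_mul_mem_P _ hs)

/-- The normal trace of a Raviart–Thomas field on a face. -/
theorem raviartThomas_normal {d : ℤ} {u : Fin 3 → Poly 3} (hu : u ∈ raviartThomas d) (i : Fin 4) :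
    faceHom i (dotC (gradLam i) u) ∈ P 2 d := by
  obtain ⟨s, -, h⟩ := raviartThomas_dotC hu
  have := affHom_mem_P (vtx (i.succAbove 0)) (faceTan i) (h i)
  change faceHom i _ ∈ _ at this
  rwa [map_sub, map_mul, faceHom_lam_self, zero_mul, sub_zero] at this

theorem sum_dotC_gradLam (u : Fin 3 → Poly 3) : ∑ i, dotC (gradLam i) u = 0 := by
  simp [Fin.sum_univ_four, Fin.sum_univ_three, dotC_apply, gradLam]
  ring

/-- Dividing ∇λ_i · u - λ_i s by λ_i shows that every w_i equals s up to degree d - 1. The s cancels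
in differences. The last relation holds because the barycentric gradients sum to zero. -/
theorem raviartThomas_decomp {d : ℤ} {u : Fin 3 → Poly 3} (hu : u ∈ raviartThomas d)
    (h0 : ∀ i, faceHom i (dotC (gradLam i) u) = 0) :
    ∃ w : Fin 4 → Poly 3, (∀ i, dotC (gradLam i) u = lam i * w i) ∧
      (∀ i j, w i - w j ∈ P 3 (d - 1)) ∧ ∑ i, lam i * w i = 0 := by
  choose w hw using fun i => lam_dvd (h0 i)
  obtain ⟨s, -, h⟩ := raviartThomas_dotC hu
  have h1 : ∀ i, w i - s ∈ P 3 (d - 1) := fun i => by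
    refine mem_P_of_mul_mem (lam_totalDegree i) ?_
    rw [mul_sub, ← hw]; exact h i
  refine ⟨w, hw, fun i j => ?_, ?_⟩
  · simpa using Submodule.sub_mem _ (h1 i) (h1 j)
  · simp_rw [← hw]; exact sum_dotC_gradLam u

theorem eq_of_dotC_gradLam {u : Fin 3 → Poly 3} (h : ∀ i, dotC (gradLam i) u = 0) : u = 0 := by
  ext1 i
  have := h i.castSucc
  fin_cases i <;> simpa [dotC_apply, gradLam, Fin.sum_univ_three] using this

/-- A Raviart–Thomas field with vanishing normal traces is a combination of the bubbles. -/
theorem raviartThomas_bubble {d : ℤ} {u : Fin 3 → Poly 3} (hu : u ∈ raviartThomas d)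
    (h0 : ∀ i, faceHom i (dotC (gradLam i) u) = 0) :
    ∃ q : Fin 3 → Poly 3, (∀ r, q r ∈ P 3 (d - 1)) ∧ ∀ i, u i = ∑ r, q r * divBubble r i := by
  obtain ⟨w, hw, hd, hs⟩ := raviartThomas_decomp hu h0
  -- The determinant of ∇λ_0, ∇λ_1, ∇λ_2 is 1/8, whence the factor 8. The three bubbles carry d = 3,
  -- 0, 1; the missing label 2 is the reference of the differences. The sign alternates because a
  -- cyclic shift of four labels is odd.
  refine ⟨![C 8 * (w 2 - w 3), C 8 * (w 0 - w 2), C 8 * (w 2 - w 1)], fun r => ?_, fun i => ?_⟩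
  · fin_cases r <;> exact C_mul_mem_P _ (hd _ _)
  · refine MvPolynomial.funext fun y => ?_
    -- From ∑ λ_j = 1 and ∑ λ_j w_j = 0, each λ_i w_i equals λ_i ∑ λ_j (w_i - w_j), which involves
    -- only differences.
    have hi := congrArg (eval y) (hw i.castSucc)
    rw [Fin.sum_univ_four] at hs
    have hs := congrArg (eval y) hs
    have hl := congrArg (eval y) sum_lam
    fin_cases i <;>
    simp [dotC_apply, gradLam, Fin.sum_univ_three, divBubble, label, grad_lam, crossProduct] at hi hs hl ⊢
    · linear_combination 2 * hi + 2 * eval y (lam 0) * (hs - eval y (w 0) * hl)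
    · linear_combination 2 * hi + 2 * eval y (lam 1) * (hs - eval y (w 1) * hl)
    · linear_combination 2 * hi + 2 * eval y (lam 2) * (hs - eval y (w 2) * hl)

/-! ### The Nédélec space -/

theorem affHom_dotC {n : ℕ} (o : Fin 3 → ℝ) (t : Fin n → Fin 3 → ℝ) (a : Fin 3 → ℝ)
    (u : Fin 3 → Poly 3) : affHom o t (dotC a u) = dotC a fun i => affHom o t (u i) := by
  simp [dotC_apply]

/-- The determinant `det (o, s, a)`, for constant vectors `o` and `a`. -/
noncomputable def det3 {n : ℕ} (o a : Fin 3 → ℝ) (s : Fin 3 → Poly n) : Poly n :=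
  dotC (crossProduct a o) s

theorem det3_mem_P {n : ℕ} (o a : Fin 3 → ℝ) {d : ℤ} {s : Fin 3 → Poly n} (h : ∀ i, s i ∈ P n d) :
    det3 o a s ∈ P n d := dotC_mem_P _ h

/-- The tangential component of a Nédélec field on an affine subspace. -/
theorem affHom_dotC_crossProduct {n : ℕ} (o : Fin 3 → ℝ) (t : Fin n → Fin 3 → ℝ) (a : Fin 3 → ℝ)
    (v s : Fin 3 → Poly 3) : affHom o t (dotC a (v + crossProduct X s)) =
      dotC a (fun i => affHom o t (v i)) + det3 o a (fun i => affHom o t (s i)) +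
        ∑ b, X b * det3 (t b) a (fun i => affHom o t (s i)) := by
  refine MvPolynomial.funext fun y => ?_
  have h : ∀ b, eval y (X b * det3 (t b) a fun i => affHom o t (s i)) =
      y b * t b 0 * (a 2 * eval y (affHom o t (s 1)) - a 1 * eval y (affHom o t (s 2))) +
      y b * t b 1 * (a 0 * eval y (affHom o t (s 2)) - a 2 * eval y (affHom o t (s 0))) +
      y b * t b 2 * (a 1 * eval y (affHom o t (s 0)) - a 0 * eval y (affHom o t (s 1))) := fun b => by
    simp [dotC_apply, det3, crossProduct, Fin.sum_univ_three]; ring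
  simp only [map_add, map_sum, h, Finset.sum_add_distrib, ← Finset.sum_mul, affHom_dotC]
  simp [dotC_apply, det3, crossProduct, Fin.sum_univ_three, affHom_X, mul_comm (t _ _)]
  ring

/-- The only term of degree d + 1 carries the determinant det (t, s, t) with the edge tangent t
repeated, which is zero. -/
theorem nedelec_edge {d : ℤ} {u : Fin 3 → Poly 3} (hu : u ∈ nedelec d) (a b : Fin 4) :
    edgeHom a b (dotC (vtx b - vtx a) u) ∈ P 1 d := by
  obtain ⟨v, hv, s, hs, rfl⟩ := mem_nedelec.1 hu
  rw [edgeHom, affHom_dotC_crossProduct]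
  have : ∀ s : Fin 3 → Poly 1, det3 (vtx b - vtx a) (vtx b - vtx a) s = 0 := fun s => by
    simp [det3, cross_self, dotC_apply]
  simp only [this, mul_zero, Finset.sum_const_zero, add_zero]
  exact Submodule.add_mem _ (dotC_mem_P _ fun i => affHom_mem_P _ _ (hv i))
    (det3_mem_P _ _ fun i => affHom_mem_P _ _ (hs i))

/-- The two tangents of the face and their difference run along its three edges, and on each edge
the corresponding component vanishes. -/
theorem faceHom_edge (i : Fin 4) (u : Fin 3 → Poly 3)
    (h : ∀ a b : Fin 4, a < b → edgeHom a b (dotC (vtx b - vtx a) u) = 0) :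
    X 1 ∣ faceHom i (dotC (faceTan i 0) u) ∧ X 0 ∣ faceHom i (dotC (faceTan i 1) u) ∧
      1 - X 0 - X 1 ∣ faceHom i (dotC (faceTan i 1) u) - faceHom i (dotC (faceTan i 0) u) := by
  have hlt : ∀ p q : Fin 3, p < q → i.succAbove p < i.succAbove q := fun p q h =>
    (Fin.strictMono_succAbove i) h
  refine ⟨X_one_dvd ?_, X_zero_dvd ?_, diag_dvd ?_⟩
  · rw [← h _ _ (hlt 0 1 (by decide))]
    exact affHom_affHom _ _ _ _ _ _ _ (by simp) (by simp [faceTan])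
  · rw [← h _ _ (hlt 0 2 (by decide))]
    exact affHom_affHom _ _ _ _ _ _ _ (by simp) (by simp [faceTan])
  · rw [← h _ _ (hlt 1 2 (by decide)), ← map_sub]
    rw [show dotC (faceTan i 1) u - dotC (faceTan i 0) u =
      dotC (vtx (i.succAbove 2) - vtx (i.succAbove 1)) u by
        simp [dotC_apply, faceTan, Fin.sum_univ_three]; ring]
    exact affHom_affHom _ _ _ _ _ _ _ (by simp [faceTan]) (by simp [faceTan])

theorem X_totalDegree {n : ℕ} (i : Fin n) : 1 ≤ (X i : Poly n).totalDegree := by simp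

theorem diag_totalDegree : 1 ≤ (1 - X 0 - X 1 : Poly 2).totalDegree :=
  one_le_totalDegree ![0, 0] ![1, 0] (by simp)

/-- Factors of the tangential trace on a face of a Nédélec field that vanishes along the edges. -/
theorem nedelec_face {d : ℤ} {u : Fin 3 → Poly 3} (hu : u ∈ nedelec d)
    (h : ∀ a b : Fin 4, a < b → edgeHom a b (dotC (vtx b - vtx a) u) = 0) (i : Fin 4) :
    ∃ w : Fin 3 → Poly 2, faceHom i (dotC (faceTan i 0) u) = X 1 * w 0 ∧
      faceHom i (dotC (faceTan i 1) u) = X 0 * w 1 ∧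
      X 0 * w 1 - X 1 * w 0 = (1 - X 0 - X 1) * w 2 ∧
      w 0 - w 2 ∈ P 2 (d - 1) ∧ w 1 + w 2 ∈ P 2 (d - 1) := by
  obtain ⟨⟨w0, h0⟩, ⟨w1, h1⟩, ⟨w2, h2⟩⟩ := faceHom_edge i u h
  obtain ⟨v, hv, s, hs, rfl⟩ := mem_nedelec.1 hu
  have hA : ∀ a, dotC (faceTan i a) (fun j => faceHom i (v j)) +
      det3 (vtx (i.succAbove 0)) (faceTan i a) (fun j => faceHom i (s j)) ∈ P 2 d := fun a =>
    Submodule.add_mem _ (dotC_mem_P _ fun i => affHom_mem_P _ _ (hv i))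
      (det3_mem_P _ _ fun i => affHom_mem_P _ _ (hs i))
  have h0' := affHom_dotC_crossProduct (vtx (i.succAbove 0)) (faceTan i) (faceTan i 0) v s
  have h1' := affHom_dotC_crossProduct (vtx (i.succAbove 0)) (faceTan i) (faceTan i 1) v s
  rw [show affHom (vtx (i.succAbove 0)) (faceTan i) = faceHom i from rfl] at h0' h1'
  -- The two face components are polynomials of degree d plus `X 1 * D` and minus `X 0 * D`. Hence
  -- w0, -w1 and w2 all equal D up to degree d - 1.
  set D := det3 (faceTan i 1) (faceTan i 0) (fun j => faceHom i (s j)) with hD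
  have hself : ∀ a, det3 (faceTan i a) (faceTan i a) (fun j => faceHom i (s j)) = 0 := fun a => by
    simp [det3, cross_self, dotC_apply]
  have hanti : det3 (faceTan i 0) (faceTan i 1) (fun j => faceHom i (s j)) = -D := by
    simp [hD, det3, crossProduct, dotC_apply, Fin.sum_univ_three]; ring
  rw [Fin.sum_univ_two, hself] at h0' h1'
  rw [hanti] at h1'
  rw [← hD] at h0'
  have e0 : w0 - D ∈ P 2 (d - 1) := by
    refine mem_P_of_mul_mem (X_totalDegree 1) ?_
    convert hA 0 using 1
    linear_combination h0' - h0
  have e1 : w1 + D ∈ P 2 (d - 1) := by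
    refine mem_P_of_mul_mem (X_totalDegree 0) ?_
    convert hA 1 using 1
    linear_combination h1' - h1
  have e2 : w2 - D ∈ P 2 (d - 1) := by
    refine mem_P_of_mul_mem diag_totalDegree ?_
    convert Submodule.sub_mem _ (Submodule.sub_mem _ (hA 1) (hA 0)) (det3_mem_P (faceTan i 1) (faceTan i 0)
      fun j => affHom_mem_P (vtx (i.succAbove 0)) (faceTan i) (hs j)) using 1
    rw [show affHom (vtx (i.succAbove 0)) (faceTan i) = faceHom i from rfl, ← hD]
    linear_combination h1' - h0' - h2
  refine ⟨![w0, w1, w2], h0, h1, ?_, ?_, ?_⟩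
  · simp only [Matrix.cons_val]; rw [← h2, h0, h1]
  · simpa using Submodule.sub_mem _ e0 e2
  · simpa using Submodule.add_mem _ e1 e2

/-! ### Nédélec fields without tangential traces -/

theorem dotC_vtx_edge (u : Fin 3 → Poly 3) (a b c : Fin 4) :
    dotC (vtx b - vtx a) u + dotC (vtx c - vtx b) u = dotC (vtx c - vtx a) u := by
  simp only [dotC_apply, ← Finset.sum_add_distrib, ← add_mul, ← C_add, Pi.sub_apply]
  simp

theorem faceHom_dotC_edge {u : Fin 3 → Poly 3} {i : Fin 4}
    (h : ∀ m, faceHom i (dotC (faceTan i m) u) = 0) (a b : Fin 4) (ha : a ≠ i) (hb : b ≠ i) :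
    faceHom i (dotC (vtx b - vtx a) u) = 0 := by
  have key : ∀ p : Fin 3, faceHom i (dotC (vtx (i.succAbove p) - vtx (i.succAbove 0)) u) = 0 := by
    intro p
    fin_cases p
    · simp [dotC_apply]
    · exact h 0
    · exact h 1
  obtain ⟨p, rfl⟩ := Fin.exists_succAbove_eq ha
  obtain ⟨q, rfl⟩ := Fin.exists_succAbove_eq hb
  have := congrArg (faceHom i) (dotC_vtx_edge u (i.succAbove 0) (i.succAbove p) (i.succAbove q))
  rwa [map_add, key, key, zero_add] at this

theorem faceHom_lam_ne_zero {i j : Fin 4} (h : j ≠ i) : faceHom i (lam j) ≠ 0 := by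
  obtain ⟨p, rfl⟩ := Fin.exists_succAbove_eq h
  intro h0
  have h1 : ∀ y : Fin 2 → ℝ, eval y (faceHom i (lam (i.succAbove p))) = 0 := fun y => by simp [h0]
  rw [faceHom_lam] at h1
  fin_cases p
  · simpa using h1 0
  · simpa using h1 1
  · simpa using h1 1

/-- After division by λ_i the quotient still vanishes on face j, because λ_i is not zero there. -/
theorem lam_mul_lam_dvd {p : Poly 3} {i j : Fin 4} (hij : i ≠ j) (hi : faceHom i p = 0)
    (hj : faceHom j p = 0) : ∃ w, p = lam i * lam j * w := by
  obtain ⟨m, rfl⟩ := lam_dvd hi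
  rw [map_mul, mul_eq_zero, or_iff_right (faceHom_lam_ne_zero hij)] at hj
  obtain ⟨w, rfl⟩ := lam_dvd hj
  exact ⟨w, by ring⟩

/-- The sum is (x - v_a) · u, because x - v_a = ∑ λ_b (v_b - v_a). The term of degree d + 2 would be
x · (x × s), which is zero. -/
theorem nedelec_position {d : ℤ} {u : Fin 3 → Poly 3} (hu : u ∈ nedelec d) (a : Fin 4) :
    ∑ b, lam b * dotC (vtx b - vtx a) u ∈ P 3 (d + 1) := by
  obtain ⟨v, hv, s, hs, rfl⟩ := mem_nedelec.1 hu
  have key : ∑ b, lam b * dotC (vtx b - vtx a) (v + crossProduct X s) =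
      ∑ i, (X i - C (vtx a i)) * v i - dotC (vtx a) (crossProduct X s) := by
    refine MvPolynomial.funext fun y => ?_
    simp only [dotC_apply, Fin.sum_univ_four, Fin.sum_univ_three, Pi.add_apply, cross_apply]
    fin_cases a <;> simp [lam, vtx] <;> ring
  have hX : ∀ i j, X i * s j ∈ P 3 (d + 1) := fun i j => by
    rw [add_comm d]; exact mul_mem_P (X_mem_P le_rfl i) (hs j)
  rw [key]
  refine Submodule.sub_mem _ (Submodule.sum_mem _ fun i _ => ?_) (dotC_mem_P _ fun i => ?_)
  · rw [add_comm d]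
    exact mul_mem_P (Submodule.sub_mem _ (X_mem_P le_rfl i) (C_mem_P (by norm_num) _)) (hv i)
  · fin_cases i <;> exact Submodule.sub_mem _ (hX _ _) (hX _ _)

theorem eq_of_dotC_vtx {u : Fin 3 → Poly 3} {q : Fin 3 → Poly 3}
    (h : ∀ i : Fin 3, dotC (vtx 3 - vtx i.castSucc) u = -2 * q i) : u = q := by
  ext1 i
  refine MvPolynomial.funext fun y => ?_
  have := congrArg (eval y) (h i)
  fin_cases i <;> simp [dotC_apply, vtx, Fin.sum_univ_three] at this ⊢ <;> linarith

/-- A Nédélec field with vanishing tangential traces is a combination of the bubbles. -/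
theorem nedelec_bubble {d : ℤ} {u : Fin 3 → Poly 3} (hu : u ∈ nedelec d)
    (h0 : ∀ i m, faceHom i (dotC (faceTan i m) u) = 0) :
    ∃ q : Fin 3 → Poly 3, (∀ r, q r ∈ P 3 (d - 2)) ∧ ∀ i, u i = ∑ r, q r * curlBubble r i := by
  -- The component along an edge vanishes on the two faces containing it, those opposite to the two
  -- other vertices, and so has the product of their barycentric coordinates as a factor.
  have hf := fun i a b => faceHom_dotC_edge (h0 i) a b
  obtain ⟨w01, h01⟩ := lam_mul_lam_dvd (p := dotC (vtx 1 - vtx 0) u) (i := 2) (j := 3) (by decide)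
    (hf _ _ _ (by decide) (by decide)) (hf _ _ _ (by decide) (by decide))
  obtain ⟨w02, h02⟩ := lam_mul_lam_dvd (p := dotC (vtx 2 - vtx 0) u) (i := 1) (j := 3) (by decide)
    (hf _ _ _ (by decide) (by decide)) (hf _ _ _ (by decide) (by decide))
  obtain ⟨w03, h03⟩ := lam_mul_lam_dvd (p := dotC (vtx 3 - vtx 0) u) (i := 1) (j := 2) (by decide)
    (hf _ _ _ (by decide) (by decide)) (hf _ _ _ (by decide) (by decide))
  obtain ⟨w12, h12⟩ := lam_mul_lam_dvd (p := dotC (vtx 2 - vtx 1) u) (i := 0) (j := 3) (by decide)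
    (hf _ _ _ (by decide) (by decide)) (hf _ _ _ (by decide) (by decide))
  obtain ⟨w13, h13⟩ := lam_mul_lam_dvd (p := dotC (vtx 3 - vtx 1) u) (i := 0) (j := 2) (by decide)
    (hf _ _ _ (by decide) (by decide)) (hf _ _ _ (by decide) (by decide))
  obtain ⟨w23, h23⟩ := lam_mul_lam_dvd (p := dotC (vtx 3 - vtx 2) u) (i := 0) (j := 1) (by decide)
    (hf _ _ _ (by decide) (by decide)) (hf _ _ _ (by decide) (by decide))
  have hneg : ∀ a b, dotC (vtx b - vtx a) u = -dotC (vtx a - vtx b) u := fun a b => by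
    have := dotC_vtx_edge u a b a
    rw [sub_self (vtx a), show dotC 0 u = 0 by simp [dotC_apply]] at this
    exact eq_neg_of_add_eq_zero_left this
  have hself : ∀ a, dotC (vtx a - vtx a) u = 0 := fun a => by simp [dotC_apply]
  -- Edge components add up around each triangle; the coordinate of the fourth vertex is a common
  -- factor and is cancelled.
  have c012 : lam 2 * w01 + lam 0 * w12 = lam 1 * w02 := by
    refine mul_left_cancel₀ (lam_ne_zero 3) ?_
    have := dotC_vtx_edge u 0 1 2
    rw [h01, h02, h12] at this; linear_combination this
  have c013 : lam 3 * w01 + lam 0 * w13 = lam 1 * w03 := by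
    refine mul_left_cancel₀ (lam_ne_zero 2) ?_
    have := dotC_vtx_edge u 0 1 3
    rw [h01, h03, h13] at this; linear_combination this
  have c023 : lam 3 * w02 + lam 0 * w23 = lam 2 * w03 := by
    refine mul_left_cancel₀ (lam_ne_zero 1) ?_
    have := dotC_vtx_edge u 0 2 3
    rw [h02, h03, h23] at this; linear_combination this
  have c123 : lam 3 * w12 + lam 1 * w23 = lam 2 * w13 := by
    refine mul_left_cancel₀ (lam_ne_zero 0) ?_
    have := dotC_vtx_edge u 1 2 3
    rw [h12, h13, h23] at this; linear_combination this
  have hdeg : ∀ a b c : Fin 4, ∀ q : Poly 3, lam a * (lam b * (lam c * q)) ∈ P 3 (d + 1) →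
      q ∈ P 3 (d - 2) := fun a b c q h => by
    have := mem_P_of_mul_mem (lam_totalDegree c) (mem_P_of_mul_mem (lam_totalDegree b)
      (mem_P_of_mul_mem (lam_totalDegree a) h))
    rwa [show d + 1 - 1 - 1 - 1 = d - 2 by ring] at this
  have hp := nedelec_position hu
  simp only [Fin.sum_univ_four] at hp
  -- In (x - v_a) · u the three other barycentric coordinates factor out, so `nedelec_position`
  -- gives degree d + 1 - 3. The individual w's need not satisfy this bound.
  have q0 : w01 + w02 + w03 ∈ P 3 (d - 2) := hdeg 1 2 3 _ (by
    convert hp 0 using 1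
    rw [hself, h01, h02, h03]; ring)
  have q1 : -w01 + w12 + w13 ∈ P 3 (d - 2) := hdeg 0 2 3 _ (by
    convert hp 1 using 1
    rw [hself, hneg 1 0, h01, h12, h13]; ring)
  have q3 : w03 + w13 + w23 ∈ P 3 (d - 2) := hdeg 0 1 2 _ (by
    convert Submodule.neg_mem _ (hp 3) using 1
    rw [hself, hneg 3 0, hneg 3 1, hneg 3 2, h03, h13, h23]; ring)
  refine ⟨![w01 + w02 + w03, w02 + w03 + w12 + w13, w03 + w13 + w23], fun r => ?_, ?_⟩
  · fin_cases r
    · exact q0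
    -- The term w01 cancels between the sums at vertices 0 and 1.
    · convert Submodule.add_mem _ q0 q1 using 1
      simp only [Fin.mk_one, Matrix.cons_val]
      ring
    · exact q3
  · refine funext_iff.1 (eq_of_dotC_vtx fun i => MvPolynomial.funext fun y => ?_)
    have hl := congrArg (eval y) sum_lam
    fin_cases i
    · have c1 := congrArg (eval y) c013
      have c2 := congrArg (eval y) c023
      have h := congrArg (eval y) h03
      simp [label, curlBubble, grad_lam, gradLam, Fin.sum_univ_three] at h hl c1 c2 ⊢
      linear_combination h - eval y (lam 1) * eval y (lam 2) * (eval y w03 * hl + c1 + c2)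
    · have c1 := congrArg (eval y) c013
      have c2 := congrArg (eval y) c123
      have h := congrArg (eval y) h13
      simp [label, curlBubble, grad_lam, gradLam, Fin.sum_univ_three] at h hl c1 c2 ⊢
      linear_combination h + eval y (lam 0) * eval y (lam 2) * (c1 - c2 - eval y w13 * hl)
    · have c1 := congrArg (eval y) c023
      have c2 := congrArg (eval y) c123
      have h := congrArg (eval y) h23
      simp [label, curlBubble, grad_lam, gradLam, Fin.sum_univ_three] at h hl c1 c2 ⊢
      linear_combination h + eval y (lam 0) * eval y (lam 1) * (c1 + c2 - eval y w23 * hl)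

/-! ### Traces of matrix fields -/

/-- An integer formula for the Levi-Civita symbol. -/
def leviZ (i j k l : Fin 4) : ℤ :=
  if i = j ∨ i = k ∨ i = l ∨ j = k ∨ j = l ∨ k = l then 0 else
  (if j < i then -1 else 1) * (if k < i then -1 else 1) * (if l < i then -1 else 1) *
  (if k < j then -1 else 1) * (if l < j then -1 else 1) * (if l < k then -1 else 1)

/-- Over ℤ the 256 cases are decidable; `leviCivita_eq` carries the result to ℝ by casting the
determinant. -/
theorem det_leviZ : ∀ i j k l : Fin 4,
    Matrix.det (Matrix.of fun a b : Fin 4 => if ![i, j, k, l] a = b then (1 : ℤ) else 0) =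
      leviZ i j k l := by
  intro i j k l
  simp only [Matrix.det_succ_row_zero, Fin.sum_univ_succ]
  simp [Matrix.submatrix, Fin.succAbove]
  revert i j k l
  decide +kernel

theorem leviCivita_eq (i j k l : Fin 4) : leviCivita i j k l = (leviZ i j k l : ℝ) := by
  rw [← det_leviZ, Int.cast_det, leviCivita]
  congr 1
  ext a b
  simp

/-- The factor 2 appears because the entries kl and lk contribute equally. -/
theorem cross4_skew_dot (n ν : Fin 4 → ℝ) (w : Fin 6 → ℝ) : cross4 n (skew w) ⬝ᵥ ν =
    2 * (ν 0 * (n 1 * w 5 - n 2 * w 4 + n 3 * w 3) + ν 1 * (n 2 * w 2 - n 0 * w 5 - n 3 * w 1) +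
      ν 2 * (n 0 * w 4 - n 1 * w 2 + n 3 * w 0) + ν 3 * (n 1 * w 1 - n 0 * w 3 - n 2 * w 0)) := by
  simp only [cross4, dotProduct, leviCivita_eq, Fin.sum_univ_four, skew]
  simp [leviZ]
  ring

/-- The matrix field with 1-form part `E` and 2-form part `H`. -/
noncomputable def field (E H : Fin 3 → Poly 4) : Field2 := skewN E + skewRT H

theorem at4_field (E H : Fin 3 → Poly 4) (x : Fin 4 → ℝ) : at4 (field E H) x =
    skew ![eval x (H 2), -eval x (H 1), eval x (E 0), eval x (H 0), eval x (E 1), eval x (E 2)] := by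
  ext i j
  fin_cases i <;> fin_cases j <;> simp [at4, field, skewN, skewRT, skew]

/-- The pullback of `[n × F] · ν` under an affine parametrisation. -/
noncomputable def trace {m : ℕ} (o : Fin 4 → ℝ) (t : Fin m → Fin 4 → ℝ) (n ν : Fin 4 → ℝ) :
    Field2 →ₗ[ℝ] Poly m :=
  ∑ i, ∑ j, ∑ k, ∑ l, (leviCivita i j k l * n j * ν i) •
    (affHom o t).toLinearMap ∘ₗ Matrix.entryLinearMap ℝ (Poly 4) k l

theorem eval_trace {m : ℕ} (o : Fin 4 → ℝ) (t : Fin m → Fin 4 → ℝ) (n ν : Fin 4 → ℝ) (F : Field2)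
    (y : Fin m → ℝ) : eval y (trace o t n ν F) = cross4 n (at4 F (aff o t y)) ⬝ᵥ ν := by
  simp only [trace, LinearMap.sum_apply, map_sum, LinearMap.smul_apply, LinearMap.comp_apply, smul_eval,
    AlgHom.toLinearMap_apply, eval_affHom, cross4, dotProduct, Finset.sum_mul, at4, aff,
    Matrix.entryLinearMap_apply, Matrix.map_apply]
  refine Finset.sum_congr rfl fun i _ => Finset.sum_congr rfl fun j _ => Finset.sum_congr rfl
    fun k _ => Finset.sum_congr rfl fun l _ => ?_
  ring

/-- With the two lemmas that follow, this decouples the parts: E drops out of the trace on the ends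
and of the axial trace on the sides, H out of the remaining side trace. -/
theorem trace_horizontal {m : ℕ} (o : Fin 4 → ℝ) (t : Fin m → Fin 4 → ℝ) (h : ℝ) (a : Fin 3 → ℝ)
    (E H : Fin 3 → Poly 4) : trace o t ![0, 0, 0, h] (join a 0) (field E H) =
      C (2 * h) * affHom o t (dotC a H) := by
  refine MvPolynomial.funext fun y => ?_
  rw [eval_trace, at4_field, cross4_skew_dot]
  simp [join, dotC_apply, Fin.sum_univ_three, eval_affHom, aff]
  ring

theorem trace_axial {m : ℕ} (o : Fin 4 → ℝ) (t : Fin m → Fin 4 → ℝ) (g : Fin 3 → ℝ) (c : ℝ)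
    (E H : Fin 3 → Poly 4) : trace o t (join g 0) ![0, 0, 0, c] (field E H) =
      C (-2 * c) * affHom o t (dotC g H) := by
  refine MvPolynomial.funext fun y => ?_
  rw [eval_trace, at4_field, cross4_skew_dot]
  simp [join, dotC_apply, Fin.sum_univ_three, eval_affHom, aff]
  ring

theorem trace_lateral {m : ℕ} (o : Fin 4 → ℝ) (t : Fin m → Fin 4 → ℝ) (g a : Fin 3 → ℝ)
    (E H : Fin 3 → Poly 4) : trace o t (join g 0) (join a 0) (field E H) =
      C 2 * affHom o t (dotC (crossProduct a g) E) := by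
  refine MvPolynomial.funext fun y => ?_
  rw [eval_trace, at4_field, cross4_skew_dot]
  simp [join, dotC_apply, Fin.sum_univ_three, eval_affHom, aff, cross_apply]
  ring

theorem contract_field_skewN (E H q : Fin 3 → Poly 4) :
    contract (field E H) (skewN q) = 2 * ∑ i, E i * q i := by
  simp [contract, field, skewN, skewRT, skew, Fin.sum_univ_four, Fin.sum_univ_three]
  ring

theorem contract_field_skewRT (E H q : Fin 3 → Poly 4) :
    contract (field E H) (skewRT q) = 2 * ∑ i, H i * q i := by
  simp [contract, field, skewN, skewRT, skew, Fin.sum_univ_four, Fin.sum_univ_three]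
  ring

/-! ### Tensor products of polynomials -/

section tmul
variable {m : ℕ}

theorem tmul_add_right (p : Poly 1) (u v : Poly m) : tmul p (u + v) = tmul p u + tmul p v := by
  simp [tmul, liftInit, mul_add]

theorem tmul_smul_right (p : Poly 1) (c : ℝ) (u : Poly m) : tmul p (c • u) = c • tmul p u := by
  simp [tmul, liftInit]

theorem tmul_add_left (p q : Poly 1) (u : Poly m) : tmul (p + q) u = tmul p u + tmul q u := by
  simp [tmul, liftLast, add_mul]

theorem tmul_smul_left (p : Poly 1) (c : ℝ) (u : Poly m) : tmul (c • p) u = c • tmul p u := by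
  simp [tmul, liftLast]

/-- `tmul` as a bilinear map. -/
noncomputable def tmulₗ : Poly 1 →ₗ[ℝ] Poly m →ₗ[ℝ] Poly (m + 1) :=
  LinearMap.mk₂ ℝ tmul tmul_add_left (fun c p u => tmul_smul_left p c u) tmul_add_right
    (fun c p u => tmul_smul_right p c u)

theorem tmulₗ_apply (p : Poly 1) (u : Poly m) : tmulₗ p u = tmul p u := rfl

theorem tmul_zero (p : Poly 1) : tmul p (0 : Poly m) = 0 := (tmulₗ p).map_zero

theorem tmul_sub_right (p : Poly 1) (u v : Poly m) : tmul p (u - v) = tmul p u - tmul p v :=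
  (tmulₗ p).map_sub u v

theorem tmul_mul_right (p : Poly 1) (u v : Poly m) : tmul p (u * v) = tmul p u * liftInit v := by
  simp [tmul, liftInit, mul_assoc]

theorem tmul_mul_left (p q : Poly 1) (u : Poly m) : tmul (p * q) u = liftLast p * tmul q u := by
  simp [tmul, liftLast, mul_assoc]

theorem tmul_mem_tensor {A : Submodule ℝ (Poly 1)} {B : Submodule ℝ (Poly m)} {p : Poly 1} {u : Poly m}
    (hp : p ∈ A) (hu : u ∈ B) : tmul p u ∈ tensor A B :=
  Submodule.subset_span ⟨p, hp, u, hu, rfl⟩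

/-- Linearly independent first factors separate the second factors. -/
theorem eq_zero_of_sum_tmul {ι : Type*} [Fintype ι] {p : ι → Poly 1} (hp : LinearIndependent ℝ p)
    {w : ι → Poly m} (h : ∑ j, tmul (p j) (w j) = 0) : ∀ j, w j = 0 := by
  intro j
  refine MvPolynomial.funext fun y => ?_
  rw [map_zero]
  refine Fintype.linearIndependent_iff.1 hp (fun j => eval y (w j)) ?_ j
  -- Freezing the first m variables at y leaves a linear relation among the p_j with coefficients
  -- w_j(y).
  have := congrArg (aeval (R := ℝ) (Fin.lastCases (X 0) fun i => C (y i) : Fin (m + 1) → Poly 1)) h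
  rw [map_sum, map_zero] at this
  rw [← this]
  refine Finset.sum_congr rfl fun j _ => ?_
  rw [tmul, map_mul, liftLast, liftInit, aeval_rename, aeval_rename]
  have e1 : ((Fin.lastCases (X 0) fun i => C (y i) : Fin (m + 1) → Poly 1) ∘ fun _ : Fin 1 =>
      Fin.last m) = X := by
    ext1 i; fin_cases i; simp
  have e2 : ((Fin.lastCases (X 0) fun i => C (y i) : Fin (m + 1) → Poly 1) ∘ Fin.castSucc) =
      fun i => C (y i) := by
    ext1 i; simp
  rw [e1, e2, aeval_X_left_apply, smul_eq_C_mul, mul_comm]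
  congr 1
  have : (aeval fun i => (C (y i) : Poly 1)) = (Algebra.ofId ℝ (Poly 1)).comp (aeval (R := ℝ) y) :=
    algHom_ext fun i => by simp [Algebra.ofId_apply]
  rw [this, AlgHom.comp_apply, Algebra.ofId_apply, aeval_eq_eval]
  rfl

end tmul

/-- The affine map of the unit interval onto the segment `[-1, 1]`. -/
noncomputable def seg : Poly 1 →ₐ[ℝ] Poly 1 := affHom ![-1] fun _ => ![2]

theorem seg_mem_P {d : ℤ} {p : Poly 1} (hp : p ∈ P 1 d) : seg p ∈ P 1 d := affHom_mem_P _ _ hp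

theorem seg_injective : Function.Injective seg := by
  refine Function.LeftInverse.injective (g := affHom ![1 / 2] fun _ => ![1 / 2]) fun p => ?_
  refine MvPolynomial.funext fun y => ?_
  rw [seg, eval_affHom, eval_affHom]
  congr 2
  ext i; fin_cases i; simp; ring

theorem affHom_tmul {m : ℕ} {o : Fin 4 → ℝ} {t : Fin (m + 1) → Fin 4 → ℝ} {o' : Fin 3 → ℝ}
    {t' : Fin m → Fin 3 → ℝ} (ho : o = join o' (-1)) (ht : ∀ a, t a.castSucc = join (t' a) 0)
    (ht' : t (Fin.last m) = ![0, 0, 0, 2]) (p : Poly 1) (u : Poly 3) :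
    affHom o t (tmul p u) = tmul (seg p) (affHom o' t' u) := by
  refine MvPolynomial.funext fun y => ?_
  simp only [tmul, map_mul, liftLast, liftInit, eval_affHom, eval_rename, seg]
  congr 3
  · ext i
    simp only [Function.comp_apply, Pi.add_apply, Finset.sum_apply, Pi.smul_apply, Fin.sum_univ_castSucc]
    fin_cases i
    simp [ho, ht, ht', join]
  · ext i
    simp only [Function.comp_apply, Pi.add_apply, Finset.sum_apply, Pi.smul_apply, Fin.sum_univ_castSucc]
    fin_cases i <;> simp [ho, ht, ht', join]

theorem affHom_tmul_end {m : ℕ} {o : Fin 4 → ℝ} {t : Fin m → Fin 4 → ℝ} {o' : Fin 3 → ℝ} {h : ℝ}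
    {t' : Fin m → Fin 3 → ℝ} (ho : o = join o' h) (ht : ∀ a, t a = join (t' a) 0) (p : Poly 1) (u : Poly 3) :
    affHom o t (tmul p u) = C (eval ![h] p) * affHom o' t' u := by
  refine MvPolynomial.funext fun y => ?_
  simp only [tmul, map_mul, liftLast, liftInit, eval_affHom, eval_rename, eval_C]
  congr 3
  · ext i
    simp only [Function.comp_apply, Pi.add_apply, Finset.sum_apply, Pi.smul_apply]
    fin_cases i
    simp [ho, ht, join]
  · ext i
    simp only [Function.comp_apply, Pi.add_apply, Finset.sum_apply, Pi.smul_apply]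
    fin_cases i <;> simp [ho, ht, join]

/-! ### The regions of integration -/

theorem region_of_closed {n : ℕ} {D : Set (Fin n → ℝ)} (h : IsClosed D) (b : D ⊆ Set.Icc (-1) 1)
    (c : Fin n → ℝ) (hc : ∀ y : Fin n → ℝ, (∀ i, |y i - c i| < 1 / 8) → y ∈ D) : Region D where
  compact := isCompact_Icc.of_isClosed_subset h b
  cube := by
    refine ⟨c, 1 / 8, by norm_num, fun y hy => hc y fun i => ?_⟩
    rw [ball_pi _ (by norm_num)] at hy
    simpa [Real.dist_eq] using hy i (Set.mem_univ i)

theorem region_triDom : Region triDom := by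
  refine region_of_closed ?_ ?_ ![1 / 4, 1 / 4] fun y hy => ?_
  · change IsClosed ({y : Fin 2 → ℝ | 0 ≤ y 0} ∩ ({y : Fin 2 → ℝ | 0 ≤ y 1} ∩ ({y : Fin 2 → ℝ | y 0 + y 1 ≤ 1})))
    exact (isClosed_le (by fun_prop) (by fun_prop)).inter ((isClosed_le (by fun_prop) (by fun_prop)).inter (isClosed_le (by fun_prop) (by fun_prop)))
  · rintro y ⟨h0, h1, h2⟩
    constructor <;> intro i <;> fin_cases i <;> simp <;> linarith
  · have h0 := abs_lt.1 (hy 0)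
    have h1 := abs_lt.1 (hy 1)
    simp at h0 h1
    refine ⟨?_, ?_, ?_⟩ <;> linarith

theorem region_quadDom : Region quadDom := by
  refine region_of_closed ?_ ?_ ![1 / 4, 1 / 4] fun y hy => ?_
  · change IsClosed ({y : Fin 2 → ℝ | 0 ≤ y 0} ∩ ({y : Fin 2 → ℝ | y 0 ≤ 1} ∩ ({y : Fin 2 → ℝ | 0 ≤ y 1} ∩ ({y : Fin 2 → ℝ | y 1 ≤ 1}))))
    exact (isClosed_le (by fun_prop) (by fun_prop)).inter ((isClosed_le (by fun_prop) (by fun_prop)).inter ((isClosed_le (by fun_prop) (by fun_prop)).inter (isClosed_le (by fun_prop) (by fun_prop))))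
  · rintro y ⟨h0, h1, h2, h3⟩
    constructor <;> intro i <;> fin_cases i <;> simp <;> linarith
  · have h0 := abs_lt.1 (hy 0)
    have h1 := abs_lt.1 (hy 1)
    simp at h0 h1
    refine ⟨?_, ?_, ?_, ?_⟩ <;> linarith

theorem region_prismDom : Region prismDom := by
  refine region_of_closed ?_ ?_ ![1 / 4, 1 / 4, 1 / 4] fun y hy => ?_
  · change IsClosed ({y : Fin 3 → ℝ | 0 ≤ y 0} ∩ ({y : Fin 3 → ℝ | 0 ≤ y 1} ∩ ({y : Fin 3 → ℝ | y 0 + y 1 ≤ 1} ∩ ({y : Fin 3 → ℝ | 0 ≤ y 2} ∩ ({y : Fin 3 → ℝ | y 2 ≤ 1})))))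
    exact (isClosed_le (by fun_prop) (by fun_prop)).inter ((isClosed_le (by fun_prop) (by fun_prop)).inter ((isClosed_le (by fun_prop) (by fun_prop)).inter ((isClosed_le (by fun_prop) (by fun_prop)).inter (isClosed_le (by fun_prop) (by fun_prop)))))
  · rintro y ⟨h0, h1, h2, h3, h4⟩
    constructor <;> intro i <;> fin_cases i <;> simp <;> linarith
  · have h0 := abs_lt.1 (hy 0)
    have h1 := abs_lt.1 (hy 1)
    have h2 := abs_lt.1 (hy 2)
    simp at h0 h1 h2
    refine ⟨?_, ?_, ?_, ?_, ?_⟩ <;> linarith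

theorem isClosed_cube {n : ℕ} : IsClosed {x : Fin n → ℝ | ∀ i, -1 ≤ x i ∧ x i ≤ 1} := by
  convert (isClosed_Icc : IsClosed (Set.Icc (-1 : Fin n → ℝ) 1)) using 1
  ext x
  simp [Pi.le_def, forall_and]

theorem region_T3 : Region T3 := by
  have hc : IsClosed {x : Fin 3 → ℝ | x 0 + x 1 + x 2 ≤ -1} := isClosed_le (by fun_prop) (by fun_prop)
  refine region_of_closed (isClosed_cube.inter hc)
    (fun x hx => ⟨fun i => (hx.1 i).1, fun i => (hx.1 i).2⟩) ![-(3 / 4), -(3 / 4), -(3 / 4)] fun y hy => ?_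
  have h0 := abs_lt.1 (hy 0)
  have h1 := abs_lt.1 (hy 1)
  have h2 := abs_lt.1 (hy 2)
  simp at h0 h1 h2
  refine ⟨fun i => ?_, by linarith⟩
  fin_cases i <;> simp <;> constructor <;> linarith

theorem region_W4 : Region W4 := by
  have hc : IsClosed {x : Fin 4 → ℝ | x 0 + x 1 + x 2 ≤ -1} := isClosed_le (by fun_prop) (by fun_prop)
  refine region_of_closed (isClosed_cube.inter hc)
    (fun x hx => ⟨fun i => (hx.1 i).1, fun i => (hx.1 i).2⟩)
    ![-(3 / 4), -(3 / 4), -(3 / 4), -(3 / 4)] fun y hy => ?_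
  have h0 := abs_lt.1 (hy 0)
  have h1 := abs_lt.1 (hy 1)
  have h2 := abs_lt.1 (hy 2)
  have h3 := abs_lt.1 (hy 3)
  simp at h0 h1 h2 h3
  refine ⟨fun i => ?_, by linarith⟩
  fin_cases i <;> simp <;> constructor <;> linarith

/-! ### Surface measures and normals -/

/-- The surface measure of the unit parameter cell. -/
noncomputable def surfC {m : ℕ} (t : Fin m → Fin 4 → ℝ) : ℝ :=
  Real.sqrt (Matrix.det (Matrix.of fun a b => t a ⬝ᵥ t b))

theorem surfC_tri (i : Fin 4) : surfC (triTangent i) ≠ 0 := by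
  rw [surfC, Real.sqrt_ne_zero', Matrix.det_fin_two]
  fin_cases i <;>
    simp [triTangent, vtx, join, Fin.succAbove, Fin.lt_def, dotProduct, Fin.sum_univ_four] <;> norm_num

theorem surfC_quad (e : Fin 6) : surfC (quadTangent e) ≠ 0 := by
  rw [surfC, Real.sqrt_ne_zero', Matrix.det_fin_two]
  fin_cases e <;>
    simp [quadTangent, edge, vtx, join, dotProduct, Fin.sum_univ_four] <;> norm_num

theorem surfC_tet : surfC tetTangent ≠ 0 := by
  rw [surfC, Real.sqrt_ne_zero', Matrix.det_fin_three]
  simp [tetTangent, dotProduct, Fin.sum_univ_four]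

theorem surfC_prism (i : Fin 4) : surfC (prismTangent i) ≠ 0 := by
  rw [surfC, Real.sqrt_ne_zero', Matrix.det_fin_three]
  fin_cases i <;>
    simp [prismTangent, vtx, join, Fin.succAbove, Fin.lt_def, dotProduct, Fin.sum_univ_four] <;> norm_num

theorem unit_smul {m : ℕ} {v : Fin m → ℝ} (hv : v ≠ 0) : ∃ c : ℝ, c ≠ 0 ∧ unit v = c • v := by
  refine ⟨_, inv_ne_zero ?_, rfl⟩
  rw [Real.sqrt_ne_zero']
  exact lt_of_le_of_ne (Finset.sum_nonneg fun i _ => mul_self_nonneg _)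
    (Ne.symm (mt dotProduct_self_eq_zero.1 hv))

theorem gradLam_ne_zero (i : Fin 4) : gradLam i ≠ 0 := by
  intro h
  have := congrFun h
  fin_cases i
  · simpa [gradLam] using this 0
  · simpa [gradLam] using this 1
  · simpa [gradLam] using this 2
  · simpa [gradLam] using this 2

theorem normal3_eq (i : Fin 4) : ∃ c : ℝ, c ≠ 0 ∧ normal3 i = c • gradLam i := by
  have h : (fun j => -eval 0 (grad (lam i) j)) = -gradLam i := by ext j; simp [grad_lam]
  obtain ⟨c, hc, h'⟩ := unit_smul (neg_ne_zero.2 (gradLam_ne_zero i))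
  exact ⟨-c, neg_ne_zero.2 hc, by rw [normal3, h, h', smul_neg, neg_smul]⟩

/-- Edge tangents are recovered from the conormal used on quadrilateral faces. -/
theorem conormal_cross (e : Fin 6) : ∃ c : ℝ, c ≠ 0 ∧
    crossProduct (unit (crossProduct (normal3 (edge e).2.2) (vtx (edge e).2.1 - vtx (edge e).1)))
      (normal3 (edge e).2.2) = c • (vtx (edge e).2.1 - vtx (edge e).1) := by
  obtain ⟨c, hc, h⟩ := normal3_eq (edge e).2.2
  set g := gradLam (edge e).2.2 with hg
  set τ := vtx (edge e).2.1 - vtx (edge e).1 with hτ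
  have horth : g ⬝ᵥ τ = 0 := by
    rw [hg, hτ]
    fin_cases e <;> simp [gradLam, vtx, edge, dotProduct, Fin.sum_univ_three]
  -- Triple product expansion; the second term disappears since the edge is orthogonal to the
  -- normal.
  have hd' : crossProduct (crossProduct g τ) g = (g ⬝ᵥ g) • τ := by
    ext j
    rw [dotProduct, Fin.sum_univ_three] at horth
    fin_cases j <;> simp [cross_apply, dotProduct, Fin.sum_univ_three]
    · linear_combination -g 0 * horth
    · linear_combination -g 1 * horth
    · linear_combination -g 2 * horth
  have hd : g ⬝ᵥ g ≠ 0 := mt dotProduct_self_eq_zero.1 (gradLam_ne_zero _)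
  have hne : crossProduct g τ ≠ 0 := by
    intro h0
    rw [h0, LinearMap.map_zero₂] at hd'
    have hv : vtx (edge e).2.1 = vtx (edge e).1 :=
      sub_eq_zero.1 ((smul_eq_zero.1 hd'.symm).resolve_left hd)
    have h1 := eval_lam_vtx (edge e).1 (edge e).1
    rw [← hv, eval_lam_vtx, if_pos rfl, if_neg (by fin_cases e <;> decide)] at h1
    exact zero_ne_one h1
  rw [h]
  obtain ⟨f, hf, h'⟩ := unit_smul (smul_ne_zero hc hne)
  -- The factor f normalises the conormal, and c enters twice because the unit normal occurs twice.
  refine ⟨f * c * c * (g ⬝ᵥ g), by positivity, ?_⟩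
  rw [LinearMap.map_smul₂, h', map_smul, LinearMap.map_smul₂, LinearMap.map_smul₂, hd']
  simp only [smul_smul]
  ring_nf

/-- The coefficients, on the tangents of a face, of the inverse of `x ↦ x × ∇λ_i`. -/
noncomputable def rot (i : Fin 4) (a b : Fin 2) : ℝ :=
  gradLam (i.succAbove a.succ) ⬝ᵥ crossProduct (gradLam i) (faceTan i b) / (gradLam i ⬝ᵥ gradLam i)

/-- On vectors orthogonal to g = ∇λ_i, the map x ↦ x × g is inverted by x ↦ g × x / |g|². The
gradients at the two non-base vertices of the face read off coefficients on its tangents. -/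
theorem rot_spec (i : Fin 4) (b : Fin 2) :
    ∑ a, rot i a b • crossProduct (faceTan i a) (gradLam i) = faceTan i b := by
  ext j
  simp only [rot, dotProduct, Fin.sum_univ_three, Fin.sum_univ_two, cross_apply]
  fin_cases i <;> fin_cases b <;> fin_cases j <;>
    simp [gradLam, faceTan, vtx, Fin.succAbove, Fin.lt_def] <;> norm_num

/-! ### Moments as integrals of polynomials -/

theorem triMoment_eq (F : Field2) (i : Fin 4) (s : Fin 2) (q : Poly 2) : triMoment F i s q =
    surfC (triTangent i) * region_triDom.integral
      (trace (triOrigin i s) (triTangent i) ![0, 0, 0, height s] (join (normal3 i) 0) F * q) := by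
  simp only [Region.integral_apply, map_mul, eval_trace]
  rfl

theorem quadMoment_eq (F : Field2) (e : Fin 6) (q : Poly 2) : quadMoment F e q =
    surfC (quadTangent e) * region_quadDom.integral
      (trace (quadOrigin e) (quadTangent e) (join (normal3 (edge e).2.2) 0)
        (join (unit (crossProduct (normal3 (edge e).2.2) (vtx (edge e).2.1 - vtx (edge e).1))) 0) F * q) := by
  simp only [Region.integral_apply, map_mul, eval_trace]
  rfl

theorem tetMoment_eq (F : Field2) (s : Fin 2) (q : Fin 3 → Poly 3) : tetMoment F s q =
    surfC tetTangent * region_T3.integral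
      (∑ a, trace ![0, 0, 0, height s] tetTangent ![0, 0, 0, height s] (tetTangent a) F * q a) := by
  rw [Region.integral_apply]
  simp only [map_sum, map_mul, eval_trace, tetMoment, surfInt, dotProduct_sum,
    dotProduct_smul, smul_eq_mul, surfC, mul_comm (eval _ (q _))]

theorem prismMoment_eq (F : Field2) (i : Fin 4) (q : Fin 3 → Poly 3) : prismMoment F i q =
    surfC (prismTangent i) * region_prismDom.integral
      (∑ a, trace (prismOrigin i) (prismTangent i) (join (normal3 i) 0) (prismTangent i a) F * q a) := by
  rw [Region.integral_apply]
  simp only [map_sum, map_mul, eval_trace, prismMoment, surfInt, dotProduct_sum,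
    dotProduct_smul, smul_eq_mul, surfC, mul_comm (eval _ (q _))]

theorem dotC_smul {n : ℕ} (c : ℝ) (a : Fin 3 → ℝ) (u : Fin 3 → Poly n) :
    dotC (c • a) u = C c * dotC a u := by
  simp [dotC_apply, Finset.mul_sum, mul_assoc]

/-- The constant collects the surface measure, the factor 2 and the normalisation of the normal.
Only its being nonzero matters, here and in the analogues below. -/
theorem triMoment_field (i : Fin 4) (s : Fin 2) : ∃ c : ℝ, c ≠ 0 ∧ ∀ E H q,
    triMoment (field E H) i s q = c * region_triDom.integral
      (affHom (triOrigin i s) (triTangent i) (dotC (gradLam i) H) * q) := by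
  obtain ⟨c, hc, h⟩ := normal3_eq i
  refine ⟨surfC (triTangent i) * (2 * height s * c), mul_ne_zero (surfC_tri i) (mul_ne_zero ?_ hc),
    fun E H q => ?_⟩
  · fin_cases s <;> simp [height]
  rw [triMoment_eq, trace_horizontal, h, dotC_smul, map_mul (affHom _ _), affHom_C, ← mul_assoc, ← C_mul, mul_assoc,
    C_mul', map_smul, smul_eq_mul]
  ring

theorem quadMoment_field (e : Fin 6) : ∃ c : ℝ, c ≠ 0 ∧ ∀ E H q,
    quadMoment (field E H) e q = c * region_quadDom.integral
      (affHom (quadOrigin e) (quadTangent e) (dotC (vtx (edge e).2.1 - vtx (edge e).1) E) * q) := by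
  obtain ⟨c, hc, h⟩ := conormal_cross e
  refine ⟨surfC (quadTangent e) * (2 * c), mul_ne_zero (surfC_quad e) (mul_ne_zero two_ne_zero hc),
    fun E H q => ?_⟩
  rw [quadMoment_eq, trace_lateral, h, dotC_smul, map_mul (affHom _ _), affHom_C, ← mul_assoc, ← C_mul, mul_assoc,
    C_mul', map_smul, smul_eq_mul]
  ring

theorem tetMoment_field (s : Fin 2) : ∃ c : ℝ, c ≠ 0 ∧ ∀ E H q,
    tetMoment (field E H) s q = c * region_T3.integral
      (∑ a, affHom ![0, 0, 0, height s] tetTangent (H a) * q a) := by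
  refine ⟨surfC tetTangent * (2 * height s), mul_ne_zero surfC_tet ?_, fun E H q => ?_⟩
  · fin_cases s <;> simp [height]
  have h : ∀ a, trace ![0, 0, 0, height s] tetTangent ![0, 0, 0, height s] (tetTangent a) (field E H) =
      C (2 * height s) * affHom ![0, 0, 0, height s] tetTangent (H a) := fun a => by
    have e : tetTangent a = join (Pi.single a 1) 0 := by
      ext j; fin_cases a <;> fin_cases j <;> simp [tetTangent, join]
    rw [e, trace_horizontal]
    congr 2
    simp [dotC_apply, Pi.single_apply]
  simp only [tetMoment_eq, h, mul_assoc, ← Finset.mul_sum]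
  rw [C_mul', map_smul, smul_eq_mul]
  ring

theorem prismTangent_castSucc (i : Fin 4) (a : Fin 2) :
    prismTangent i a.castSucc = join (faceTan i a) 0 := by
  fin_cases a <;> rfl

theorem prismMoment_axial (i : Fin 4) : ∃ c : ℝ, c ≠ 0 ∧ ∀ E H q,
    prismMoment (field E H) i ![0, 0, q] = c * region_prismDom.integral
      (affHom (prismOrigin i) (prismTangent i) (dotC (gradLam i) H) * q) := by
  obtain ⟨c, hc, h⟩ := normal3_eq i
  refine ⟨surfC (prismTangent i) * (-2 * 2 * c), mul_ne_zero (surfC_prism i)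
    (mul_ne_zero (by norm_num) hc), fun E H q => ?_⟩
  rw [prismMoment_eq, Fin.sum_univ_three]
  simp only [Matrix.cons_val, mul_zero, zero_add]
  rw [show prismTangent i 2 = ![0, 0, 0, 2] from rfl, trace_axial, h, dotC_smul, map_mul (affHom _ _), affHom_C,
    ← mul_assoc, ← C_mul, mul_assoc, C_mul', map_smul, smul_eq_mul]
  ring

/-- The trace pairs with tangential components of E rotated by a quarter turn; recombining the test
field by `rot` undoes the rotation. -/
theorem prismMoment_tangential (i : Fin 4) : ∃ c : ℝ, c ≠ 0 ∧ ∀ E H (q : Fin 2 → Poly 3),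
    prismMoment (field E H) i ![∑ b, C (rot i 0 b) * q b, ∑ b, C (rot i 1 b) * q b, 0] =
      c * region_prismDom.integral
        (∑ b, affHom (prismOrigin i) (prismTangent i) (dotC (faceTan i b) E) * q b) := by
  obtain ⟨c, hc, h⟩ := normal3_eq i
  refine ⟨surfC (prismTangent i) * (2 * c), mul_ne_zero (surfC_prism i)
    (mul_ne_zero two_ne_zero hc), fun E H q => ?_⟩
  have h1 : ∀ a : Fin 2, trace (prismOrigin i) (prismTangent i) (join (normal3 i) 0)
      (prismTangent i a.castSucc) (field E H) = C (2 * c) *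
        affHom (prismOrigin i) (prismTangent i) (dotC (crossProduct (faceTan i a) (gradLam i)) E) := by
    intro a
    rw [prismTangent_castSucc, trace_lateral, h, map_smul, dotC_smul, map_mul (affHom _ _), affHom_C, ← mul_assoc,
      ← C_mul]
  have h2 : ∀ b, dotC (faceTan i b) E = ∑ a, C (rot i a b) *
      dotC (crossProduct (faceTan i a) (gradLam i)) E := by
    intro b
    conv_lhs => rw [← rot_spec i b]
    simp [dotC_apply, Fin.sum_univ_three, Fin.sum_univ_two]
    ring
  rw [prismMoment_eq, mul_assoc, ← smul_eq_mul (2 * c), ← map_smul]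
  congr 2
  have h10 := h1 0
  have h11 := h1 1
  simp only [Fin.castSucc_zero, Fin.castSucc_one] at h10 h11
  simp only [Fin.sum_univ_three, Matrix.cons_val, h10, h11, h2, smul_eq_C_mul, map_add, map_mul, affHom_C,
    Fin.sum_univ_two]
  ring

theorem volMoment1_field (E H : Fin 3 → Poly 4) (q : Fin 3 → Poly 4) :
    volMoment1 (field E H) q = 2 * region_W4.integral
      (∑ i, E i * ∑ r, q r * liftInit (curlBubble r i)) := by
  simp only [volMoment1, contract_field_skewN]
  rw [← smul_eq_mul 2 (region_W4.integral _), ← map_smul, Region.integral_apply]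
  simp

theorem volMoment2_field (E H : Fin 3 → Poly 4) (q : Fin 3 → Poly 4) :
    volMoment2 (field E H) q = 2 * region_W4.integral
      (∑ i, H i * ∑ r, q r * liftInit (divBubble r i) * liftLast segBubble) := by
  simp only [volMoment2, contract_field_skewRT]
  rw [← smul_eq_mul 2 (region_W4.integral _), ← map_smul, Region.integral_apply]
  simp

/-! ### Unisolvence for families of fields -/

theorem linearIndependent_seg {ι : Type*} {p : ι → Poly 1} (hp : LinearIndependent ℝ p) :
    LinearIndependent ℝ fun j => seg (p j) :=
  hp.map' seg.toLinearMap (LinearMap.ker_eq_bot.2 seg_injective)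

section family
variable {ι : Type*} [Fintype ι]

/-- The field `∑ j, p_j(x_4) u_j(x_1, x_2, x_3)`. -/
noncomputable def comb (p : ι → Poly 1) (u : ι → Fin 3 → Poly 3) : Fin 3 → Poly 4 :=
  fun i => ∑ j, tmul (p j) (u j i)

theorem dotC_comb (a : Fin 3 → ℝ) (p : ι → Poly 1) (u : ι → Fin 3 → Poly 3) :
    dotC a (comb p u) = ∑ j, tmul (p j) (dotC a (u j)) := by
  simp only [dotC_apply, comb, Finset.mul_sum]
  rw [Finset.sum_comm]
  refine Finset.sum_congr rfl fun j _ => ?_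
  simp only [C_mul', ← tmulₗ_apply, map_sum, map_smul]

theorem sum_tmul_mem {m : ℕ} {A : Submodule ℝ (Poly 1)} {B : Submodule ℝ (Poly m)} {p : ι → Poly 1}
    {w : ι → Poly m} (hp : ∀ j, p j ∈ A) (hw : ∀ j, w j ∈ B) : ∑ j, tmul (p j) (w j) ∈ tensor A B :=
  Submodule.sum_mem _ fun j _ => tmul_mem_tensor (hp j) (hw j)

theorem affHom_prism (i : Fin 4) (a : Fin 3 → ℝ) (p : ι → Poly 1) (u : ι → Fin 3 → Poly 3) :
    affHom (prismOrigin i) (prismTangent i) (dotC a (comb p u)) =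
      ∑ j, tmul (seg (p j)) (faceHom i (dotC a (u j))) := by
  rw [dotC_comb, map_sum]
  exact Finset.sum_congr rfl fun j _ => affHom_tmul rfl (prismTangent_castSucc i) rfl _ _

theorem affHom_quad (e : Fin 6) (a : Fin 3 → ℝ) (p : ι → Poly 1) (u : ι → Fin 3 → Poly 3) :
    affHom (quadOrigin e) (quadTangent e) (dotC a (comb p u)) =
      ∑ j, tmul (seg (p j)) (edgeHom (edge e).1 (edge e).2.1 (dotC a (u j))) := by
  rw [dotC_comb, map_sum]
  exact Finset.sum_congr rfl fun j _ => affHom_tmul rfl (fun a => by fin_cases a; rfl) rfl _ _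

theorem affHom_tri (i : Fin 4) (s : Fin 2) (a : Fin 3 → ℝ) (p : ι → Poly 1) (u : ι → Fin 3 → Poly 3) :
    affHom (triOrigin i s) (triTangent i) (dotC a (comb p u)) =
      faceHom i (dotC a (∑ j, eval ![height s] (p j) • u j)) := by
  rw [dotC_comb, map_sum, map_sum, map_sum]
  refine Finset.sum_congr rfl fun j _ => ?_
  rw [map_smul, map_smul, ← C_mul']
  exact affHom_tmul_end rfl (fun a => by fin_cases a <;> rfl) _ _

theorem affHom_tet (s : Fin 2) (i : Fin 3) (p : ι → Poly 1) (u : ι → Fin 3 → Poly 3) :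
    affHom ![0, 0, 0, height s] tetTangent (comb p u i) =
      (∑ j, eval ![height s] (p j) • u j) i := by
  rw [comb, map_sum, Finset.sum_apply]
  refine Finset.sum_congr rfl fun j _ => ?_
  rw [affHom_tmul_end (o' := 0) (h := height s) (t' := fun a => Pi.single a 1), C_mul', Pi.smul_apply]
  · congr 1
    refine MvPolynomial.funext fun y => ?_
    rw [eval_affHom]
    congr 2
    ext a
    simp [Pi.single_apply]
  · ext a; fin_cases a <;> simp [join]
  · intro a; ext j; fin_cases a <;> fin_cases j <;> simp [tetTangent, join]

theorem eval_lam_nonneg {y : Fin 3 → ℝ} (hy : y ∈ T3) (i : Fin 4) : 0 ≤ eval y (lam i) := by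
  obtain ⟨h, h'⟩ := hy
  have h0 := (h 0).1
  have h1 := (h 1).1
  have h2 := (h 2).1
  fin_cases i <;> simp [lam] <;> linarith

/-- The tetrahedral facets and their faces determine the 2-form part at the ends of the segment. -/
theorem raviartThomas_end {d : ℤ} {p : ι → Poly 1} {u : ι → Fin 3 → Poly 3}
    (hu : ∀ j, u j ∈ raviartThomas d) {E : Fin 3 → Poly 4} (s : Fin 2)
    (htri : ∀ i, ∀ q ∈ P 2 d, triMoment (field E (comb p u)) i s q = 0)
    (htet : ∀ q : Fin 3 → Poly 3, (∀ a, q a ∈ P 3 (d - 1)) → tetMoment (field E (comb p u)) s q = 0) :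
    ∑ j, eval ![height s] (p j) • u j = 0 := by
  set U := ∑ j, eval ![height s] (p j) • u j with hU
  have hUm : U ∈ raviartThomas d := Submodule.sum_mem _ fun j _ => Submodule.smul_mem _ _ (hu j)
  have h0 : ∀ i, faceHom i (dotC (gradLam i) U) = 0 := by
    intro i
    obtain ⟨c, hc, h⟩ := triMoment_field i s
    -- The normal trace has the degree of the test space and is tested with itself.
    have := htri i _ (raviartThomas_normal hUm i)
    rw [h, affHom_tri, ← hU, mul_eq_zero, or_iff_right hc] at this
    exact region_triDom.eq_zero_of_sum_sq {()} (fun _ => 1) (fun _ => faceHom i (dotC (gradLam i) U))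
      (by simp) (by simp) (by simpa using this) () (by simp)
  obtain ⟨w, hw, hd, hs⟩ := raviartThomas_decomp hUm h0
  obtain ⟨c, hc, h⟩ := tetMoment_field s
  -- The differences w_i - w_3 have admissible degree, while the w_i alone need not. Because ∑ λ_i
  -- w_i = 0, subtracting w_3 does not change the integrand ∑ λ_i w_i².
  have key := htet (fun a => ∑ i, C (gradLam i a) * (w i - w 3)) fun a =>
    Submodule.sum_mem _ fun i _ => C_mul_mem_P _ (hd i 3)
  rw [h, mul_eq_zero, or_iff_right hc] at key
  simp only [affHom_tet, ← hU] at key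
  have e : ∑ a, U a * ∑ i, C (gradLam i a) * (w i - w 3) = ∑ i, lam i * (w i * w i) := by
    have : ∑ a, U a * ∑ i, C (gradLam i a) * (w i - w 3) =
        ∑ i, dotC (gradLam i) U * (w i - w 3) := by
      simp only [dotC_apply, Finset.mul_sum, Finset.sum_mul]
      rw [Finset.sum_comm]
      exact Finset.sum_congr rfl fun i _ => Finset.sum_congr rfl fun a _ => by ring
    rw [this]
    simp only [hw]
    rw [Fin.sum_univ_four] at hs ⊢
    rw [Fin.sum_univ_four]
    linear_combination -w 3 * hs
  rw [e] at key
  have hw0 := region_T3.eq_zero_of_sum_sq Finset.univ lam w (fun i _ y hy => eval_lam_nonneg hy i)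
    (fun i _ => lam_ne_zero i) key
  exact eq_of_dotC_gradLam fun i => by rw [hw, hw0 i (Finset.mem_univ i), mul_zero]

theorem eval_liftLast_segBubble {m : ℕ} (y : Fin (m + 1) → ℝ) :
    eval y (liftLast segBubble) = (1 - y (Fin.last m)) * (1 + y (Fin.last m)) / 4 := by
  simp [liftLast, segBubble]; ring

theorem eval_liftLast_seg_segBubble (y : Fin 3 → ℝ) :
    eval y (liftLast (seg segBubble)) = y 2 * (1 - y 2) := by
  simp [liftLast, segBubble, eval_rename, seg, eval_affHom]; ring

/-- Injectivity for 2-form parts that vanish at the ends of the segment. -/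
theorem raviartThomas_interior {d : ℤ} {p : ι → Poly 1} (hp : LinearIndependent ℝ p)
    (hpd : ∀ j, p j ∈ P 1 (d - 1)) {u : ι → Fin 3 → Poly 3} (hu : ∀ j, u j ∈ raviartThomas d)
    {E : Fin 3 → Poly 4}
    (hprism : ∀ i, ∀ q ∈ tensor (P 1 (d - 1)) (P 2 d),
      prismMoment (field E (comb (fun j => segBubble * p j) u)) i ![0, 0, q] = 0)
    (hvol : ∀ q : Fin 3 → Poly 4, (∀ r, q r ∈ tensor (P 1 (d - 1)) (P 3 (d - 1))) →
      volMoment2 (field E (comb (fun j => segBubble * p j) u)) q = 0) : ∀ j, u j = 0 := by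
  have h0 : ∀ j i, faceHom i (dotC (gradLam i) (u j)) = 0 := by
    intro j i
    obtain ⟨c, hc, h⟩ := prismMoment_axial i
    have hG : ∑ j, tmul (seg (p j)) (faceHom i (dotC (gradLam i) (u j))) ∈ tensor (P 1 (d - 1)) (P 2 d) :=
      sum_tmul_mem (fun j => seg_mem_P (hpd j)) fun j => raviartThomas_normal (hu j) i
    -- The test is the normal trace divided by the segment bubble, which remains as a nonnegative
    -- weight.
    have := hprism i _ hG
    rw [h, affHom_prism, mul_eq_zero, or_iff_right hc] at this
    simp only [map_mul seg, tmul_mul_left, ← Finset.mul_sum, mul_assoc] at this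
    have hl : (liftLast (seg segBubble) : Poly 3) ≠ 0 := fun h0 => by
      have := eval_liftLast_seg_segBubble ![0, 0, 1 / 2]
      simp [h0] at this
      norm_num at this
    have hz := region_prismDom.eq_zero_of_sum_sq {()} (fun _ => liftLast (seg segBubble))
      (fun _ => ∑ j, tmul (seg (p j)) (faceHom i (dotC (gradLam i) (u j))))
      (fun _ _ y hy => by
        rw [eval_liftLast_seg_segBubble]
        exact mul_nonneg hy.2.2.2.1 (sub_nonneg.2 hy.2.2.2.2))
      (fun _ _ => hl) (by simpa using this) () (by simp)
    exact eq_zero_of_sum_tmul (linearIndependent_seg hp) hz j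
  choose q hq hqu using fun j => raviartThomas_bubble (hu j) (h0 j)
  have hQ : ∀ r, ∑ j, tmul (p j) (q j r) ∈ tensor (P 1 (d - 1)) (P 3 (d - 1)) := fun r =>
    sum_tmul_mem hpd fun j => hq j r
  -- With the bubble coefficients as tests, the integrand is the squared segment bubble times the
  -- squared length of ∑ p_j u_j.
  have key := hvol _ hQ
  rw [volMoment2_field, mul_eq_zero, or_iff_right two_ne_zero] at key
  have hB : (liftLast segBubble : Poly 4) ≠ 0 := fun h0 => by
    have := eval_liftLast_segBubble (0 : Fin 4 → ℝ)
    simp [h0] at this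
  have e : ∑ i, comb (fun j => segBubble * p j) u i *
      ∑ r, (∑ j, tmul (p j) (q j r)) * liftInit (divBubble r i) * liftLast segBubble =
      ∑ i, (liftLast segBubble * liftLast segBubble) * (comb p u i * comb p u i) := by
    refine Finset.sum_congr rfl fun i _ => ?_
    have e1 : comb (fun j => segBubble * p j) u i = liftLast segBubble * comb p u i := by
      simp only [comb, tmul_mul_left, Finset.mul_sum]
    have e2 : ∑ r, (∑ j, tmul (p j) (q j r)) * liftInit (divBubble r i) = comb p u i := by
      simp only [Finset.sum_mul, ← tmul_mul_right]
      rw [Finset.sum_comm]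
      simp only [comb, hqu, ← tmulₗ_apply, map_sum]
    rw [← Finset.sum_mul, e1, e2]
    ring
  rw [e] at key
  have hz := region_W4.eq_zero_of_sum_sq Finset.univ _ _
    (fun i _ y _ => by rw [map_mul]; exact mul_self_nonneg _) (fun i _ => mul_ne_zero hB hB) key
  intro j
  ext1 i
  exact eq_zero_of_sum_tmul hp (hz i (Finset.mem_univ i)) j

/-- Injectivity for 1-form parts. -/
theorem nedelec_unisolvent {d : ℤ} {p : ι → Poly 1} (hp : LinearIndependent ℝ p)
    (hpd : ∀ j, p j ∈ P 1 d) {u : ι → Fin 3 → Poly 3} (hu : ∀ j, u j ∈ nedelec d) {H : Fin 3 → Poly 4}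
    (hquad : ∀ e, ∀ q ∈ tensor (P 1 d) (P 1 d), quadMoment (field (comb p u) H) e q = 0)
    (hprism : ∀ i, ∀ q₀ ∈ tensor (P 1 d) (P 2 (d - 1)), ∀ q₁ ∈ tensor (P 1 d) (P 2 (d - 1)),
      prismMoment (field (comb p u) H) i ![q₀, q₁, 0] = 0)
    (hvol : ∀ q : Fin 3 → Poly 4, (∀ r, q r ∈ tensor (P 1 d) (P 3 (d - 2))) →
      volMoment1 (field (comb p u) H) q = 0) : ∀ j, u j = 0 := by
  have hedge : ∀ j, ∀ a b : Fin 4, a < b → edgeHom a b (dotC (vtx b - vtx a) (u j)) = 0 := by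
    intro j a b hab
    obtain ⟨e, rfl, rfl⟩ : ∃ e, (edge e).1 = a ∧ (edge e).2.1 = b := by revert a b; decide
    obtain ⟨c, hc, h⟩ := quadMoment_field e
    have hG : ∑ j, tmul (seg (p j)) (edgeHom (edge e).1 (edge e).2.1
        (dotC (vtx (edge e).2.1 - vtx (edge e).1) (u j))) ∈ tensor (P 1 d) (P 1 d) :=
      sum_tmul_mem (fun j => seg_mem_P (hpd j)) fun j => nedelec_edge (hu j) _ _
    have := hquad e _ hG
    rw [h, affHom_quad, mul_eq_zero, or_iff_right hc] at this
    have hz := region_quadDom.eq_zero_of_sum_sq {()} (fun _ => 1) (fun _ => ∑ j, tmul (seg (p j))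
      (edgeHom (edge e).1 (edge e).2.1 (dotC (vtx (edge e).2.1 - vtx (edge e).1) (u j))))
      (by simp) (by simp) (by simpa using this) () (by simp)
    exact eq_zero_of_sum_tmul (linearIndependent_seg hp) hz j
  have hface : ∀ j i m, faceHom i (dotC (faceTan i m) (u j)) = 0 := by
    intro j i
    choose w h0 h1 h2 hd0 hd1 using fun j => nedelec_face (hu j) (hedge j) i
    set W : Fin 3 → Poly 3 := fun c => ∑ j, tmul (seg (p j)) (w j c) with hW
    have hps : ∀ j, seg (p j) ∈ P 1 d := fun j => seg_mem_P (hpd j)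
    have c0 : W 0 - W 2 ∈ tensor (P 1 d) (P 2 (d - 1)) := by
      simp only [hW, ← Finset.sum_sub_distrib, ← tmul_sub_right]
      exact sum_tmul_mem hps hd0
    have c1 : W 1 + W 2 ∈ tensor (P 1 d) (P 2 (d - 1)) := by
      simp only [hW, ← Finset.sum_add_distrib, ← tmul_add_right]
      exact sum_tmul_mem hps hd1
    -- The tests paired with the tangential components are W 0 - W 2 and W 1 + W 2, in which the
    -- common excess degree has cancelled.
    have hq : ∀ a, ∑ b, C (rot i a b) * ![W 0 - W 2, W 1 + W 2] b ∈ tensor (P 1 d) (P 2 (d - 1)) := by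
      intro a
      simp only [Fin.sum_univ_two, C_mul', Matrix.cons_val]
      exact Submodule.add_mem _ (Submodule.smul_mem _ _ c0) (Submodule.smul_mem _ _ c1)
    obtain ⟨c, hc, h⟩ := prismMoment_tangential i
    have key := hprism i _ (hq 0) _ (hq 1)
    rw [h, mul_eq_zero, or_iff_right hc] at key
    have hsum : ∀ (l : Poly 2) c, ∑ j, tmul (seg (p j)) (l * w j c) = liftInit l * W c := by
      intro l c
      simp only [hW, mul_comm l, tmul_mul_right, ← Finset.sum_mul, mul_comm (liftInit l)]
    have hrel : liftInit (X 0) * W 1 - liftInit (X 1) * W 0 = liftInit (1 - X 0 - X 1) * W 2 := by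
      simp only [← hsum, ← Finset.sum_sub_distrib, ← tmul_sub_right, h2]
    simp only [affHom_prism, Fin.sum_univ_two, Matrix.cons_val, h0, h1, hsum] at key
    -- By `hrel`, the cross term W 2 (X 0 W 1 - X 1 W 0) is the third square (W 2)², with weight 1 -
    -- X 0 - X 1.
    have hz := region_prismDom.eq_zero_of_sum_sq Finset.univ
      (fun c : Fin 3 => liftInit (![X 1, X 0, 1 - X 0 - X 1] c)) W (fun c _ y hy => by
        obtain ⟨g0, g1, g2, -, -⟩ := hy
        fin_cases c <;> simp [liftInit] <;> linarith)
      (fun c _ h => by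
        have h' := (rename_injective _ (Fin.castSucc_injective 2)) (h.trans (map_zero _).symm)
        have e1 := congrArg (eval ![0, 0]) h'
        have e2 := congrArg (eval ![1, 1]) h'
        fin_cases c <;> simp at e1 e2)
      (by
        rw [← key, Fin.sum_univ_three]
        simp only [Matrix.cons_val]
        congr 1
        linear_combination -W 2 * hrel)
    have hw : ∀ c, w j c = 0 := fun c =>
      eq_zero_of_sum_tmul (linearIndependent_seg hp) (hz c (Finset.mem_univ c)) j
    intro m
    fin_cases m
    · change faceHom i (dotC (faceTan i 0) (u j)) = 0
      rw [h0, hw, mul_zero]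
    · change faceHom i (dotC (faceTan i 1) (u j)) = 0
      rw [h1, hw, mul_zero]
  choose q hq hqu using fun j => nedelec_bubble (hu j) (hface j)
  -- The bubble coefficients of E are themselves admissible tests, and they reproduce E.
  have key := hvol (fun r => ∑ j, tmul (p j) (q j r)) fun r => sum_tmul_mem hpd fun j => hq j r
  rw [volMoment1_field, mul_eq_zero, or_iff_right two_ne_zero] at key
  have e : ∑ i, comb p u i * ∑ r, (∑ j, tmul (p j) (q j r)) * liftInit (curlBubble r i) =
      ∑ i, 1 * (comb p u i * comb p u i) := by
    refine Finset.sum_congr rfl fun i _ => ?_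
    have e2 : ∑ r, (∑ j, tmul (p j) (q j r)) * liftInit (curlBubble r i) = comb p u i := by
      simp only [Finset.sum_mul, ← tmul_mul_right]
      rw [Finset.sum_comm]
      simp only [comb, hqu, ← tmulₗ_apply, map_sum]
    rw [e2, one_mul]
  rw [e] at key
  have hz := region_W4.eq_zero_of_sum_sq Finset.univ _ _
    (fun i _ y _ => by simp) (fun i _ => one_ne_zero) key
  intro j
  ext1 i
  exact eq_zero_of_sum_tmul hp (hz i (Finset.mem_univ i)) j

end family

/-! ### Dimensions -/

theorem finrank_restrictSupport {n : ℕ} (s : Finset (Fin n →₀ ℕ)) :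
    Module.finrank ℝ (restrictSupport ℝ (s : Set (Fin n →₀ ℕ))) = s.card := by
  rw [Module.finrank_eq_card_basis (basisRestrictSupport ℝ (s : Set (Fin n →₀ ℕ)))]
  simp

instance finite_restrictSupport {n : ℕ} (s : Finset (Fin n →₀ ℕ)) :
    Module.Finite ℝ (restrictSupport ℝ (s : Set (Fin n →₀ ℕ))) :=
  Module.Finite.of_basis (basisRestrictSupport ℝ (s : Set (Fin n →₀ ℕ)))

theorem P_eq_restrictSupport (n m : ℕ) : P n m = restrictSupport ℝ
    (((Finset.range (m + 1)).biUnion fun e => Finset.univ.finsuppAntidiag e : Finset (Fin n →₀ ℕ)) :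
      Set (Fin n →₀ ℕ)) := by
  rw [P]
  congr 1
  ext s
  simp [Finset.mem_finsuppAntidiag, Finsupp.degree_eq_sum]
  rw [← Nat.cast_sum, Nat.cast_le]

instance finite_P (n : ℕ) (d : ℤ) : Module.Finite ℝ (P n d) := by
  rcases lt_or_ge d 0 with h | h
  · rw [P_eq_bot h]; infer_instance
  · lift d to ℕ using h
    rw [P_eq_restrictSupport]; infer_instance

theorem finrank_P_nat (n m : ℕ) : Module.finrank ℝ (P n m) = (n + m).choose m := by
  rw [P_eq_restrictSupport, finrank_restrictSupport, Finset.card_biUnion]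
  · simp [Finset.card_finsuppAntidiag_nat_eq_multichoose, Nat.sum_range_multichoose]
    rw [add_comm m n, Nat.choose_symm_add]
  · intro a _ b _ hab
    change Disjoint _ _
    rw [Finset.disjoint_left]
    intro s hs hs'
    rw [Finset.mem_finsuppAntidiag] at hs hs'
    exact hab (hs.1.symm.trans hs'.1)

/-- One formula covers negative d too: for m < c both sides are 0, and c ≤ n keeps the natural
subtraction exact. -/
theorem finrank_P {n m c : ℕ} {d : ℤ} (h : d = m - c) (hc : c ≤ n) :
    Module.finrank ℝ (P n d) = (n + m - c).choose n := by
  rcases lt_or_ge m c with hm | hm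
  · rw [P_eq_bot (by omega), finrank_bot, Nat.choose_eq_zero_of_lt (by omega)]
  · obtain ⟨e, rfl⟩ := Nat.exists_eq_add_of_le hm
    rw [show d = (e : ℤ) by push_cast at h; omega, finrank_P_nat,
      show n + (c + e) - c = n + e by omega, Nat.choose_symm_add]

theorem tensor_le_range {m : ℕ} (A : Submodule ℝ (Poly 1)) (B : Submodule ℝ (Poly m)) :
    tensor A B ≤ LinearMap.range (TensorProduct.lift (tmulₗ.compl₁₂ A.subtype B.subtype)) := by
  rw [tensor, Submodule.span_le]
  rintro _ ⟨p, hp, u, hu, rfl⟩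
  exact ⟨(⟨p, hp⟩ : A) ⊗ₜ (⟨u, hu⟩ : B), by simp [tmulₗ_apply]⟩

instance finite_tensor {m : ℕ} (A : Submodule ℝ (Poly 1)) (B : Submodule ℝ (Poly m))
    [Module.Finite ℝ A] [Module.Finite ℝ B] : Module.Finite ℝ (tensor A B) :=
  Submodule.finiteDimensional_of_le (tensor_le_range A B)

/-- Tensor products occur only in the test spaces, for which an upper bound is enough. -/
theorem finrank_tensor_le {m : ℕ} (A : Submodule ℝ (Poly 1)) (B : Submodule ℝ (Poly m))
    [Module.Finite ℝ A] [Module.Finite ℝ B] :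
    Module.finrank ℝ (tensor A B) ≤ Module.finrank ℝ A * Module.finrank ℝ B := by
  rw [← Module.finrank_tensorProduct]
  exact (Submodule.finrank_mono (tensor_le_range A B)).trans (LinearMap.finrank_range_le _)

instance finite_vecP (d : ℤ) : Module.Finite ℝ (vecP d) :=
  Module.Finite.of_injective (N := Fin 3 → P 3 d)
    (LinearMap.pi fun i => ((LinearMap.proj i).comp (vecP d).subtype).codRestrict (P 3 d)
      fun u => mem_vecP.1 u.2 i) fun u v h => by
        ext1; ext1 i; exact congrArg Subtype.val (congrFun h i)

theorem X_mul_mem_P {n : ℕ} {d : ℤ} {p : Poly n} (i : Fin n) (hp : p ∈ P n d) :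
    X i * p ∈ P n (d + 1) := by
  rw [add_comm]; exact mul_mem_P (X_mem_P le_rfl i) hp

instance finite_raviartThomas (d : ℤ) : Module.Finite ℝ (raviartThomas d) := by
  refine Submodule.finiteDimensional_of_le (S₂ := vecP (d + 1)) fun u hu => ?_
  obtain ⟨v, hv, s, hs, h⟩ := mem_raviartThomas.1 hu
  exact mem_vecP.2 fun i => by
    rw [h]; exact Submodule.add_mem _ (P_mono (by omega) (hv i)) (X_mul_mem_P i hs)

instance finite_nedelec (d : ℤ) : Module.Finite ℝ (nedelec d) := by
  refine Submodule.finiteDimensional_of_le (S₂ := vecP (d + 1)) fun u hu => ?_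
  obtain ⟨v, hv, s, hs, rfl⟩ := mem_nedelec.1 hu
  refine mem_vecP.2 fun i => Submodule.add_mem _ (P_mono (by omega) (hv i)) ?_
  fin_cases i <;> exact Submodule.sub_mem _ (X_mul_mem_P _ (hs _)) (X_mul_mem_P _ (hs _))

/-- Homogeneous polynomials of degree `d` in the variables of `s`. -/
noncomputable def homog (s : Finset (Fin 3)) (d : ℕ) : Submodule ℝ (Poly 3) :=
  restrictSupport ℝ (s.finsuppAntidiag d : Set (Fin 3 →₀ ℕ))

instance finite_homog (s : Finset (Fin 3)) (d : ℕ) : Module.Finite ℝ (homog s d) :=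
  finite_restrictSupport _

theorem finrank_homog (s : Finset (Fin 3)) (d : ℕ) :
    Module.finrank ℝ (homog s d) = (s.card + d - 1).choose d :=
  (finrank_restrictSupport _).trans (Finset.card_finsuppAntidiag_nat_eq_choose d)

theorem isHomogeneous_of_mem {s : Finset (Fin 3)} {d : ℕ} {p : Poly 3} (hp : p ∈ homog s d) :
    p.IsHomogeneous d := by
  intro m hm
  rw [← (Finset.mem_finsuppAntidiag'.1 (hp (mem_support_iff.2 hm))).1]
  simp [Finsupp.weight_apply]

theorem homog_le_P (s : Finset (Fin 3)) (d : ℕ) : homog s d ≤ P 3 d := fun _ hp =>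
  mem_P_iff.2 (Or.inr (Nat.cast_le.2 (isHomogeneous_of_mem hp).totalDegree_le))

theorem eq_zero_of_isHomogeneous {d : ℕ} {p : Poly 3} (hp : p.IsHomogeneous (d + 1)) (h : p ∈ P 3 d) :
    p = 0 := by
  by_contra h0
  rcases mem_P_iff.1 h with h | h
  · exact h0 h
  · rw [hp.totalDegree h0] at h; push_cast at h; omega

/-- Setting x_3 = 0 fixes p, which does not involve x_3, and kills the right-hand side. -/
theorem eq_zero_of_X_two_dvd {d : ℕ} {p q : Poly 3} (hp : p ∈ homog {0, 1} d)
    (h : X 1 * p = X 2 * q) : p = 0 := by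
  have key : aeval ![X 0, X 1, 0] p = p := by
    have : Set.EqOn (aeval ![X 0, X 1, 0] : Poly 3 →ₐ[ℝ] Poly 3).toLinearMap
        (LinearMap.id : Poly 3 →ₗ[ℝ] Poly 3)
        ((homog {0, 1} d : Submodule ℝ (Poly 3)) : Set (Poly 3)) := by
      rw [homog, restrictSupport_eq_span]
      refine LinearMap.eqOn_span' (R := ℝ) ?_
      rintro _ ⟨m, hm, rfl⟩
      have h2 : m 2 = 0 := by
        have := (Finset.mem_finsuppAntidiag.1 hm).2
        by_contra h0
        simpa using this (Finsupp.mem_support_iff.2 h0)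
      simp [monomial_eq, Finsupp.prod_fintype, Fin.prod_univ_three, h2]
    exact this hp
  have := congrArg (aeval ![X 0, X 1, 0] : Poly 3 →ₐ[ℝ] Poly 3) h
  rw [map_mul, map_mul, key] at this
  simpa using this

/-- Only the part of s of degree exactly d adds to (P^d)^3, and x s is then homogeneous of degree d
+ 1, so it cannot cancel against degree d. -/
theorem le_finrank_raviartThomas {d : ℕ} {e : ℤ} (he : e = d) :
    3 * (3 + d).choose d + (3 + d - 1).choose d ≤ Module.finrank ℝ (raviartThomas e) := by
  subst he
  let f : (Fin 3 → P 3 d) × homog Finset.univ d →ₗ[ℝ] raviartThomas d :=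
    { toFun := fun z => ⟨fun i => (z.1 i : Poly 3) + X i * (z.2 : Poly 3),
        mem_raviartThomas.2 ⟨_, fun i => (z.1 i).2, _, homog_le_P _ _ z.2.2, fun i => rfl⟩⟩
      map_add' := fun y z => by ext1; ext1 i; simp; ring
      map_smul' := fun c z => by ext1; ext1 i; simp }
  have hf : Function.Injective f := by
    rw [injective_iff_map_eq_zero]
    rintro ⟨v, s⟩ h
    have h1 : ∀ i, (v i : Poly 3) + X i * (s : Poly 3) = 0 := fun i => congrFun (congrArg Subtype.val h) i
    have h2 : ∀ i, X i * (s : Poly 3) = 0 := fun i =>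
      eq_zero_of_isHomogeneous (d := d) (by
        rw [add_comm d]; exact (isHomogeneous_X _ _).mul (isHomogeneous_of_mem s.2)) (by
        rw [eq_neg_of_add_eq_zero_right (h1 i)]; exact Submodule.neg_mem _ (v i).2)
    have hs : s = 0 := by ext1; simpa using h2 0
    refine Prod.ext (funext fun i => ?_) hs
    ext1; simpa [hs] using h1 i
  have := LinearMap.finrank_le_finrank_of_injective hf
  rw [Module.finrank_prod, Module.finrank_pi_fintype, finrank_homog] at this
  simpa [finrank_P_nat] using this

/-- As for Raviart–Thomas, but s ↦ x × s has the multiples of x as kernel. Taking the third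
component of s free of x_3 makes the map injective. -/
theorem le_finrank_nedelec {d : ℕ} {e : ℤ} (he : e = d) :
    3 * (3 + d).choose d + (2 * (3 + d - 1).choose d + (d + 1)) ≤ Module.finrank ℝ (nedelec e) := by
  subst he
  let f : (Fin 3 → P 3 d) × (Fin 2 → homog Finset.univ d) × homog {0, 1} d →ₗ[ℝ] nedelec d :=
    { toFun := fun z => ⟨fun i => (z.1 i : Poly 3) +
          crossProduct X ![(z.2.1 0 : Poly 3), (z.2.1 1 : Poly 3), (z.2.2 : Poly 3)] i,
        mem_nedelec.2 ⟨_, fun i => (z.1 i).2, _, fun i => by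
          fin_cases i
          · exact homog_le_P _ _ (z.2.1 0).2
          · exact homog_le_P _ _ (z.2.1 1).2
          · exact homog_le_P _ _ z.2.2.2, rfl⟩⟩
      map_add' := fun y z => by ext1; ext1 i; fin_cases i <;> simp [cross_apply] <;> ring
      map_smul' := fun c z => by ext1; ext1 i; fin_cases i <;> simp [cross_apply, smul_sub] }
  have hf : Function.Injective f := by
    rw [injective_iff_map_eq_zero]
    rintro ⟨v, s, r⟩ h
    have h1 : ∀ i, (v i : Poly 3) + crossProduct X ![(s 0 : Poly 3), (s 1 : Poly 3), (r : Poly 3)] i = 0 :=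
      fun i => congrFun (congrArg Subtype.val h) i
    have hX : ∀ i (t : Finset (Fin 3)) (p : homog t d), (X i * (p : Poly 3)).IsHomogeneous (d + 1) :=
      fun i t p => by
        rw [add_comm d]; exact (isHomogeneous_X _ _).mul (isHomogeneous_of_mem p.2)
    have h2 : ∀ i, crossProduct X ![(s 0 : Poly 3), (s 1 : Poly 3), (r : Poly 3)] i = 0 := fun i =>
      eq_zero_of_isHomogeneous (d := d) (by
        fin_cases i <;> exact (hX _ _ _).sub (hX _ _ _)) (by
        rw [eq_neg_of_add_eq_zero_right (h1 i)]; exact Submodule.neg_mem _ (v i).2)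
    have e0 := h2 0
    have e1 := h2 1
    simp only [cross_apply, Matrix.cons_val] at e0 e1
    have hr : r = 0 := by ext1; exact eq_zero_of_X_two_dvd r.2 (sub_eq_zero.1 e0)
    have hs : s = 0 := by
      ext i : 2
      fin_cases i
      · simpa [hr] using e1
      · simpa [hr] using e0
    refine Prod.ext (funext fun i => ?_) (Prod.ext hs hr)
    ext1; simpa [h2] using h1 i
  have := LinearMap.finrank_le_finrank_of_injective hf
  rw [Module.finrank_prod, Module.finrank_prod, Module.finrank_pi_fintype, Module.finrank_pi_fintype,
    finrank_homog] at this
  simpa [finrank_P_nat, finrank_homog, Nat.add_comm 1 d] using this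

/-! ### A parametrisation of the space -/

/-- A basis of the polynomials on the segment: the two nodal functions and multiples of the bubble. -/
noncomputable def nodal (k : ℕ) : Fin 2 ⊕ Fin (k - 1) → Poly 1 :=
  Sum.elim (fun s => C (1 / 2) * (1 + C (height s) * X 0)) fun j => segBubble * X 0 ^ (j : ℕ)

theorem segBubble_eq : segBubble = C (1 / 4) * (1 - X 0 ^ 2) :=
  MvPolynomial.funext fun y => by simp [segBubble]; ring

theorem X_pow_mem_P {n : ℕ} {d : ℤ} (i : Fin n) {j : ℕ} (h : (j : ℤ) ≤ d) : (X i ^ j : Poly n) ∈ P n d :=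
  mem_P_iff.2 (Or.inr (by simpa using h))

theorem P_one_le {d : ℤ} {M : Submodule ℝ (Poly 1)} (h : ∀ j : ℕ, (j : ℤ) ≤ d → X 0 ^ j ∈ M) :
    P 1 d ≤ M := by
  rw [P, restrictSupport_eq_span, Submodule.span_le]
  rintro _ ⟨m, hm, rfl⟩
  have hm' : ((m 0 : ℕ) : ℤ) ≤ d := by
    simpa [Finsupp.degree_eq_sum] using hm
  simpa [monomial_eq, Finsupp.prod_fintype] using h _ hm'

theorem nodal_mem_P {k : ℕ} (hk : 1 ≤ k) (x : Fin 2 ⊕ Fin (k - 1)) : nodal k x ∈ P 1 k := by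
  rcases x with s | j
  · refine C_mul_mem_P _ (Submodule.add_mem _ ?_ (C_mul_mem_P _ (X_mem_P (by omega) 0)))
    rw [← C_1]; exact C_mem_P (by omega) _
  · rw [nodal, Sum.elim_inr, show (k : ℤ) = 2 + (k - 2) by ring]
    refine mul_mem_P ?_ (X_pow_mem_P 0 (by have := j.2; omega))
    rw [segBubble_eq, ← C_1]
    exact C_mul_mem_P _ (Submodule.sub_mem _ (C_mem_P (by norm_num) _) (X_pow_mem_P 0 (by norm_num)))

theorem P_le_of_nodal {k : ℕ} {M : Submodule ℝ (Poly 1)} (h : ∀ x, nodal k x ∈ M) :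
    P 1 k ≤ M := by
  refine P_one_le fun j => ?_
  induction j using Nat.strong_induction_on with
  | _ j ih =>
    intro hj
    rcases j with _ | _ | j
    · convert Submodule.add_mem _ (h (Sum.inl 0)) (h (Sum.inl 1)) using 1
      refine MvPolynomial.funext fun y => ?_
      simp [nodal, height]; ring
    · convert Submodule.sub_mem _ (h (Sum.inl 1)) (h (Sum.inl 0)) using 1
      refine MvPolynomial.funext fun y => ?_
      simp [nodal, height]; ring
    -- Uses x^(j+2) = x^j - 4 b x^j, where b = (1 - x²)/4 is the segment bubble.
    · have hlt : j < k - 1 := by push_cast at hj; omega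
      convert Submodule.sub_mem _ (ih j (by omega) (by push_cast at hj ⊢; omega))
        (M.smul_mem 4 (h (Sum.inr ⟨j, hlt⟩))) using 1
      refine MvPolynomial.funext fun y => ?_
      simp [nodal, segBubble]; ring

theorem linearIndependent_X_pow (n : ℕ) :
    LinearIndependent ℝ fun j : Fin n => (X 0 ^ (j : ℕ) : Poly 1) := by
  have h := (basisMonomials (Fin 1) ℝ).linearIndependent.comp
    (fun j : Fin n => Finsupp.single 0 (j : ℕ)) fun a b hab => by
      simpa [Fin.ext_iff] using DFunLike.congr_fun hab 0
  have e : (fun j : Fin n => (X 0 ^ (j : ℕ) : Poly 1)) =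
      basisMonomials (Fin 1) ℝ ∘ fun j : Fin n => Finsupp.single 0 (j : ℕ) := by
    ext1 j
    simp [X_pow_eq_monomial]
  rw [e]
  exact h

theorem skewN_add {R : Type*} [CommRing R] (u v : Fin 3 → R) : skewN (u + v) = skewN u + skewN v := by
  ext i j; fin_cases i <;> fin_cases j <;> simp [skewN, skew] <;> ring

theorem skewRT_add {R : Type*} [CommRing R] (u v : Fin 3 → R) :
    skewRT (u + v) = skewRT u + skewRT v := by
  ext i j; fin_cases i <;> fin_cases j <;> simp [skewRT, skew] <;> ring

/-- `skewN` as a linear map. -/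
noncomputable def skewNₗ : (Fin 3 → Poly 4) →ₗ[ℝ] Field2 where
  toFun := skewN
  map_add' := skewN_add
  map_smul' c u := by ext i j; fin_cases i <;> fin_cases j <;> simp [skewN, skew]

/-- `skewRT` as a linear map. -/
noncomputable def skewRTₗ : (Fin 3 → Poly 4) →ₗ[ℝ] Field2 where
  toFun := skewRT
  map_add' := skewRT_add
  map_smul' c u := by ext i j; fin_cases i <;> fin_cases j <;> simp [skewRT, skew]

/-- The product of a polynomial on the segment and a vector field on the tetrahedron. -/
noncomputable def tmulVec : Poly 1 →ₗ[ℝ] (Fin 3 → Poly 3) →ₗ[ℝ] (Fin 3 → Poly 4) :=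
  LinearMap.mk₂ ℝ (fun p u i => tmul p (u i)) (fun _ _ _ => funext fun _ => tmul_add_left _ _ _)
    (fun _ _ _ => funext fun _ => tmul_smul_left _ _ _) (fun _ _ _ => funext fun _ => tmul_add_right _ _ _)
    (fun _ _ _ => funext fun _ => tmul_smul_right _ _ _)

/-- `comb` as a linear map of the vector fields. -/
noncomputable def combₗ {ι : Type*} [Fintype ι] (p : ι → Poly 1) (N : Submodule ℝ (Fin 3 → Poly 3)) :
    (ι → N) →ₗ[ℝ] (Fin 3 → Poly 4) :=
  ∑ j, (tmulVec (p j)).comp (N.subtype.comp (LinearMap.proj j))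

theorem combₗ_apply {ι : Type*} [Fintype ι] (p : ι → Poly 1) (N : Submodule ℝ (Fin 3 → Poly 3))
    (u : ι → N) : combₗ p N u = comb p fun j => (u j : Fin 3 → Poly 3) := by
  ext1 i
  simp [combₗ, comb, LinearMap.sum_apply, Finset.sum_apply, tmulVec]

theorem combₗ_single {ι : Type*} [Fintype ι] [DecidableEq ι] (p : ι → Poly 1)
    (N : Submodule ℝ (Fin 3 → Poly 3)) (j : ι) (u : N) :
    combₗ p N (Pi.single j u) = tmulVec (p j) u := by
  rw [combₗ, LinearMap.sum_apply, Finset.sum_eq_single j]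
  · simp
  · intro b _ hb; simp [hb]
  · simp

/-- Coefficient vector fields of the elements of `V2 k`. -/
abbrev Coeffs (k : ℕ) : Type :=
  (Fin k → nedelec (k - 1)) × (Fin 2 ⊕ Fin (k - 1) → raviartThomas (k - 1))

/-- The matrix field with given coefficients. -/
noncomputable def ofCoeffs (k : ℕ) : Coeffs k →ₗ[ℝ] Field2 :=
  (skewNₗ.comp (combₗ (fun j : Fin k => X 0 ^ (j : ℕ)) _)).coprod (skewRTₗ.comp (combₗ (nodal k) _))

theorem ofCoeffs_apply (k : ℕ) (z : Coeffs k) : ofCoeffs k z =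
    field (comb (fun j : Fin k => X 0 ^ (j : ℕ)) fun j => (z.1 j : Fin 3 → Poly 3))
      (comb (nodal k) fun j => (z.2 j : Fin 3 → Poly 3)) := by
  rw [ofCoeffs, LinearMap.coprod_apply, LinearMap.comp_apply, LinearMap.comp_apply, combₗ_apply,
    combₗ_apply]
  rfl

/-- For fixed u the generators are linear in p, so a spanning set of axial polynomials is enough.
Injectivity of `ofCoeffs` is not needed here; it is a by-product of unisolvence. -/
theorem V2_eq_range {k : ℕ} (hk : 1 ≤ k) : V2 k = LinearMap.range (ofCoeffs k) := by
  apply le_antisymm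
  · refine sup_le (Submodule.span_le.2 ?_) (Submodule.span_le.2 ?_)
    · rintro _ ⟨p, hp, u, hu, rfl⟩
      revert p
      change P 1 (k - 1) ≤ (LinearMap.range (ofCoeffs k)).comap (skewNₗ.comp (tmulVec.flip u))
      refine P_one_le fun j hj => ?_
      refine ⟨(Pi.single ⟨j, by omega⟩ ⟨u, hu⟩, 0), ?_⟩
      rw [ofCoeffs, LinearMap.coprod_apply, map_zero, add_zero, LinearMap.comp_apply]
      rw [combₗ_single]
      rfl
    · rintro _ ⟨p, hp, u, hu, rfl⟩
      revert p
      change P 1 k ≤ (LinearMap.range (ofCoeffs k)).comap (skewRTₗ.comp (tmulVec.flip u))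
      refine P_le_of_nodal fun x => ?_
      refine ⟨(0, Pi.single x ⟨u, hu⟩), ?_⟩
      rw [ofCoeffs, LinearMap.coprod_apply, map_zero, zero_add, LinearMap.comp_apply]
      rw [combₗ_single]
      rfl
  · rintro _ ⟨z, rfl⟩
    rw [ofCoeffs, LinearMap.coprod_apply, LinearMap.comp_apply, LinearMap.comp_apply, combₗ, combₗ,
      LinearMap.sum_apply, LinearMap.sum_apply, map_sum, map_sum]
    refine Submodule.add_mem_sup (Submodule.sum_mem _ fun j _ => Submodule.subset_span ?_)
      (Submodule.sum_mem _ fun j _ => Submodule.subset_span ?_)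
    · exact ⟨_, X_pow_mem_P 0 (by have := j.2; omega), _, (z.1 j).2, rfl⟩
    · exact ⟨_, nodal_mem_P hk j, _, (z.2 j).2, rfl⟩

/-- A field given by its coefficients is determined by its degrees of freedom. -/
theorem coeffs_eq_zero {k : ℕ} (z : Coeffs k) (h : DofsVanish k (ofCoeffs k z)) :
    z = 0 := by
  rw [ofCoeffs_apply] at h
  obtain ⟨u, g⟩ := z
  have e2 : (k : ℤ) - 1 - 1 = k - 2 := by ring
  have e3 : (k : ℤ) - 1 - 2 = k - 3 := by ring
  have hu : ∀ j, (u j : Fin 3 → Poly 3) = 0 :=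
    nedelec_unisolvent (linearIndependent_X_pow k) (fun j => X_pow_mem_P 0 (by have := j.2; omega))
      (fun j => (u j).2) (fun e q hq => h.quad e ⟨q, hq⟩)
      (fun i q₀ h₀ q₁ h₁ => h.prism1 i ![⟨q₀, e2 ▸ h₀⟩, ⟨q₁, e2 ▸ h₁⟩])
      (fun q hq => h.vol1 fun r => ⟨q r, e3 ▸ hq r⟩)
  have hend : ∀ s, ∑ x, eval ![height s] (nodal k x) • (g x : Fin 3 → Poly 3) = 0 := fun s =>
    raviartThomas_end (fun x => (g x).2) s (fun i q hq => h.tri i s ⟨q, hq⟩)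
      (fun q hq => h.tet s fun a => ⟨q a, e2 ▸ hq a⟩)
  -- The bubble functions vanish at both ends, and each nodal function is 1 at its own end and 0 at
  -- the other, so an end value is a single coefficient.
  have hinr : ∀ s j, eval ![height s] (nodal k (Sum.inr j)) = 0 := fun s j => by
    fin_cases s <;> simp [nodal, segBubble, height]
  have hg0 : ∀ s, (g (Sum.inl s) : Fin 3 → Poly 3) = 0 := by
    intro s
    have := hend s
    rw [Fintype.sum_sum_type] at this
    simp only [hinr, zero_smul, Finset.sum_const_zero, add_zero, Fin.sum_univ_two] at this
    fin_cases s
    · simpa [nodal, height, ← two_mul] using this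
    · simpa [nodal, height, ← two_mul] using this
  have hH : comb (nodal k) (fun x => (g x : Fin 3 → Poly 3)) =
      comb (fun j : Fin (k - 1) => segBubble * X 0 ^ (j : ℕ)) fun j => (g (Sum.inr j) : Fin 3 → Poly 3) := by
    ext1 i
    simp [comb, Fintype.sum_sum_type, hg0, tmul_zero, nodal]
  rw [hH] at h
  have hg1 : ∀ j, (g (Sum.inr j) : Fin 3 → Poly 3) = 0 :=
    raviartThomas_interior (linearIndependent_X_pow (k - 1))
      (fun j => X_pow_mem_P 0 (by have := j.2; omega)) (fun j => (g (Sum.inr j)).2)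
      (fun i q hq => h.prism2 i ⟨q, e2 ▸ hq⟩)
      (fun q hq => h.vol2 fun r => ⟨q r, e2 ▸ hq r⟩)
  refine Prod.ext (funext fun j => Subtype.ext (hu j)) (funext fun x => Subtype.ext ?_)
  rcases x with s | j
  · exact hg0 s
  · exact hg1 j

/-! ### The degrees of freedom as a linear map -/

/-- The `L²` pairing on a region. -/
noncomputable def Region.pairing {n : ℕ} {D : Set (Fin n → ℝ)} (hD : Region D) :
    Poly n →ₗ[ℝ] Poly n →ₗ[ℝ] ℝ := (LinearMap.mul ℝ (Poly n)).compr₂ hD.integral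

theorem Region.pairing_apply {n : ℕ} {D : Set (Fin n → ℝ)} (hD : Region D) (p q : Poly n) :
    hD.pairing p q = hD.integral (p * q) := rfl

/-- The double contraction as a bilinear map. -/
noncomputable def contractₗ : Field2 →ₗ[ℝ] Field2 →ₗ[ℝ] Poly 4 :=
  LinearMap.mk₂ ℝ contract
    (fun A B M => by simp [contract, add_mul, Finset.sum_add_distrib])
    (fun c A M => by simp [contract, Finset.smul_sum])
    (fun M A B => by simp [contract, mul_add, Finset.sum_add_distrib])
    (fun c M A => by simp [contract, Finset.smul_sum])

/-- Combination of fixed vector fields with polynomial coefficients. -/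
noncomputable def bubbleSum (φ : Fin 3 → Fin 3 → Poly 4) : (Fin 3 → Poly 4) →ₗ[ℝ] (Fin 3 → Poly 4) where
  toFun q j := ∑ r, q r * φ r j
  map_add' q q' := by ext1 j; simp [add_mul, Finset.sum_add_distrib]
  map_smul' c q := by ext1 j; simp [Finset.smul_sum]

/-- Inclusion of test spaces of vector fields. -/
noncomputable def incl {ι R : Type*} [AddCommGroup R] [Module ℝ R] (A : Submodule ℝ R) :
    (ι → A) →ₗ[ℝ] (ι → R) :=
  LinearMap.pi fun i => A.subtype.comp (LinearMap.proj i)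

/-- The space of all prescriptions of the degrees of freedom. -/
abbrev DofSpace (k : ℕ) : Type :=
  (Fin 4 → Fin 2 → Module.Dual ℝ (P 2 (k - 1))) ×
  (Fin 6 → Module.Dual ℝ (tensor (P 1 (k - 1)) (P 1 (k - 1)))) ×
  (Fin 2 → Module.Dual ℝ (Fin 3 → P 3 (k - 2))) ×
  (Fin 4 → Module.Dual ℝ (Fin 2 → tensor (P 1 (k - 1)) (P 2 (k - 2)))) ×
  (Fin 4 → Module.Dual ℝ (tensor (P 1 (k - 2)) (P 2 (k - 1)))) ×
  Module.Dual ℝ (Fin 3 → tensor (P 1 (k - 1)) (P 3 (k - 3))) ×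
  Module.Dual ℝ (Fin 3 → tensor (P 1 (k - 2)) (P 3 (k - 2)))

instance finite_dual_pi {ι κ R : Type*} [Fintype ι] [Fintype κ] [AddCommGroup R] [Module ℝ R]
    [Module.Finite ℝ R] : Module.Finite ℝ (ι → Module.Dual ℝ (κ → R)) := inferInstance

instance finite_dofSpace (k : ℕ) : Module.Finite ℝ (DofSpace k) := by
  refine @Module.Finite.prod _ _ _ _ _ _ _ _ ?_ ?_ <;> infer_instance

/-- All degrees of freedom of a matrix field. -/
noncomputable def dofs (k : ℕ) : Field2 →ₗ[ℝ] DofSpace k :=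
  (LinearMap.pi fun i => LinearMap.pi fun s => surfC (triTangent i) • region_triDom.pairing.compl₁₂
    (trace (triOrigin i s) (triTangent i) ![0, 0, 0, height s] (join (normal3 i) 0))
    (P 2 (k - 1)).subtype).prod <|
  (LinearMap.pi fun e => surfC (quadTangent e) • region_quadDom.pairing.compl₁₂
    (trace (quadOrigin e) (quadTangent e) (join (normal3 (edge e).2.2) 0)
      (join (unit (crossProduct (normal3 (edge e).2.2) (vtx (edge e).2.1 - vtx (edge e).1))) 0))
    (tensor (P 1 (k - 1)) (P 1 (k - 1))).subtype).prod <|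
  (LinearMap.pi fun s => surfC tetTangent • ∑ a, region_T3.pairing.compl₁₂
    (trace ![0, 0, 0, height s] tetTangent ![0, 0, 0, height s] (tetTangent a))
    ((P 3 (k - 2)).subtype.comp (LinearMap.proj a))).prod <|
  -- Only two tangents enter, since these test fields have no axial component.
  (LinearMap.pi fun i => surfC (prismTangent i) • ∑ a : Fin 2, region_prismDom.pairing.compl₁₂
    (trace (prismOrigin i) (prismTangent i) (join (normal3 i) 0) (prismTangent i a.castSucc))
    ((tensor (P 1 (k - 1)) (P 2 (k - 2))).subtype.comp (LinearMap.proj a))).prod <|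
  (LinearMap.pi fun i => surfC (prismTangent i) • region_prismDom.pairing.compl₁₂
    (trace (prismOrigin i) (prismTangent i) (join (normal3 i) 0) (prismTangent i 2))
    (tensor (P 1 (k - 2)) (P 2 (k - 1))).subtype).prod <|
  ((contractₗ.compr₂ region_W4.integral).compl₂
    (skewNₗ ∘ₗ bubbleSum (fun r j => liftInit (curlBubble r j)) ∘ₗ incl _)).prod
  ((contractₗ.compr₂ region_W4.integral).compl₂
    (skewRTₗ ∘ₗ bubbleSum (fun r j => liftInit (divBubble r j) * liftLast segBubble) ∘ₗ incl _))

theorem hasDofs_of_dofs_eq {k : ℕ} {F : Field2} {D : DofValues k}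
    (h : dofs k F = (D.tri, D.quad, D.tet, D.prism1, D.prism2, D.vol1, D.vol2)) : HasDofs k F D := by
  have h1 : (dofs k F).1 = D.tri := congrArg (fun x => x.1) h
  have h2 : (dofs k F).2.1 = D.quad := congrArg (fun x => x.2.1) h
  have h3 : (dofs k F).2.2.1 = D.tet := congrArg (fun x => x.2.2.1) h
  have h4 : (dofs k F).2.2.2.1 = D.prism1 := congrArg (fun x => x.2.2.2.1) h
  have h5 : (dofs k F).2.2.2.2.1 = D.prism2 := congrArg (fun x => x.2.2.2.2.1) h
  have h6 : (dofs k F).2.2.2.2.2.1 = D.vol1 := congrArg (fun x => x.2.2.2.2.2.1) h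
  have h7 : (dofs k F).2.2.2.2.2.2 = D.vol2 := congrArg (fun x => x.2.2.2.2.2.2) h
  constructor
  · intro i s q
    rw [← h1, triMoment_eq]; rfl
  · intro e q
    rw [← h2, quadMoment_eq]; rfl
  · intro s q
    rw [← h3, tetMoment_eq, map_sum]
    simp [dofs, Region.pairing_apply]
  · intro i q
    rw [← h4, prismMoment_eq, map_sum, Fin.sum_univ_three]
    simp [dofs, Region.pairing_apply, Fin.sum_univ_two, mul_add]
  · intro i q
    rw [← h5, prismMoment_eq, map_sum, Fin.sum_univ_three]
    simp [dofs, Region.pairing_apply]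
  · intro q
    rw [← h6]; rfl
  · intro q
    rw [← h7]
    simp only [volMoment2, mul_assoc]
    rfl

/-- By `hasDofs_of_dofs_eq`, F attains the prescription given by its own values; two prescriptions
attained by the same F agree on every test function. -/
theorem dofs_eq_of_hasDofs {k : ℕ} {F : Field2} {D : DofValues k} (h : HasDofs k F D) :
    dofs k F = (D.tri, D.quad, D.tet, D.prism1, D.prism2, D.vol1, D.vol2) := by
  have h' : HasDofs k F ⟨(dofs k F).1, (dofs k F).2.1, (dofs k F).2.2.1, (dofs k F).2.2.2.1,
    (dofs k F).2.2.2.2.1, (dofs k F).2.2.2.2.2.1, (dofs k F).2.2.2.2.2.2⟩ := hasDofs_of_dofs_eq rfl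
  refine Prod.ext ?_ (Prod.ext ?_ (Prod.ext ?_ (Prod.ext ?_ (Prod.ext ?_ (Prod.ext ?_ ?_)))))
  · funext i s; ext1 q; exact (h'.tri i s q).symm.trans (h.tri i s q)
  · funext e; exact LinearMap.ext fun q => (h'.quad e q).symm.trans (h.quad e q)
  · funext s; exact LinearMap.ext fun q => (h'.tet s q).symm.trans (h.tet s q)
  · funext i; exact LinearMap.ext fun q => (h'.prism1 i q).symm.trans (h.prism1 i q)
  · funext i; exact LinearMap.ext fun q => (h'.prism2 i q).symm.trans (h.prism2 i q)
  · exact LinearMap.ext fun q => (h'.vol1 q).symm.trans (h.vol1 q)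
  · exact LinearMap.ext fun q => (h'.vol2 q).symm.trans (h.vol2 q)

/-! ### Bijectivity by counting dimensions -/

theorem dofs_ofCoeffs_injective (k : ℕ) : Function.Injective (dofs k ∘ₗ ofCoeffs k) := by
  rw [injective_iff_map_eq_zero]
  intro z hz
  exact coeffs_eq_zero z (hasDofs_of_dofs_eq hz)

/-- With k = d + 1, Pascal's rule expresses every binomial through d, C(d+1, 2) and C(d+1, 3), after
which the bounds combine linearly. -/
theorem finrank_dofSpace_le {k : ℕ} (hk : 1 ≤ k) :
    Module.finrank ℝ (DofSpace k) ≤ Module.finrank ℝ (Coeffs k) := by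
  obtain ⟨d, rfl⟩ : ∃ d, k = d + 1 := ⟨k - 1, by omega⟩
  have hN := le_finrank_nedelec (d := d) (e := ((d + 1 : ℕ) : ℤ) - 1) (by push_cast; ring)
  have hR := le_finrank_raviartThomas (d := d) (e := ((d + 1 : ℕ) : ℤ) - 1) (by push_cast; ring)
  have p1 : ∀ n, Module.finrank ℝ (P n (((d + 1 : ℕ) : ℤ) - 1)) = (n + d).choose n := fun n =>
    finrank_P (c := 0) (by push_cast; ring) (by omega)
  have p2 : ∀ n, 1 ≤ n → Module.finrank ℝ (P n (((d + 1 : ℕ) : ℤ) - 2)) = (n + d - 1).choose n :=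
    fun n hn => finrank_P (c := 1) (by push_cast; ring) hn
  have p3 : Module.finrank ℝ (P 3 (((d + 1 : ℕ) : ℤ) - 3)) = (3 + d - 2).choose 3 :=
    finrank_P (c := 2) (by push_cast; ring) (by omega)
  have t1 := finrank_tensor_le (P 1 (((d + 1 : ℕ) : ℤ) - 1)) (P 1 (((d + 1 : ℕ) : ℤ) - 1))
  have t2 := finrank_tensor_le (P 1 (((d + 1 : ℕ) : ℤ) - 1)) (P 2 (((d + 1 : ℕ) : ℤ) - 2))
  have t3 := finrank_tensor_le (P 1 (((d + 1 : ℕ) : ℤ) - 2)) (P 2 (((d + 1 : ℕ) : ℤ) - 1))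
  have t4 := finrank_tensor_le (P 1 (((d + 1 : ℕ) : ℤ) - 1)) (P 3 (((d + 1 : ℕ) : ℤ) - 3))
  have t5 := finrank_tensor_le (P 1 (((d + 1 : ℕ) : ℤ) - 2)) (P 3 (((d + 1 : ℕ) : ℤ) - 2))
  simp only [Module.finrank_prod, Module.finrank_pi_fintype, Subspace.dual_finrank_eq, Finset.sum_const,
    Finset.card_univ, Fintype.card_fin, Fintype.card_sum, smul_eq_mul]
  have c1 : (1 + d).choose 1 = d + 1 := by rw [Nat.choose_one_right, add_comm]
  have c2 : (1 + d - 1).choose 1 = d := by rw [Nat.choose_one_right]; omega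
  have c3 : (2 + d - 1).choose 2 = (d + 1).choose 2 := by congr 1; omega
  have c4 : (2 + d).choose 2 = d + 1 + (d + 1).choose 2 := by
    rw [show 2 + d = d + 1 + 1 by omega, Nat.choose_succ_succ' (d + 1) 1, Nat.choose_one_right]
  have c5 : (3 + d - 2).choose 3 = (d + 1).choose 3 := by congr 1; omega
  have c6 : (3 + d - 1).choose 3 = (d + 1).choose 2 + (d + 1).choose 3 := by
    rw [show 3 + d - 1 = d + 1 + 1 by omega, Nat.choose_succ_succ' (d + 1) 2]
  have c7 : (3 + d - 1).choose d = d + 1 + (d + 1).choose 2 := by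
    rw [show 3 + d - 1 = 2 + d by omega, Nat.choose_symm_add.symm, c4]
  have c8 : (3 + d).choose d = d + 1 + (d + 1).choose 2 + ((d + 1).choose 2 + (d + 1).choose 3) := by
    rw [← c6, ← c4, Nat.choose_symm_add.symm, show 3 + d = 2 + d + 1 by omega,
      Nat.choose_succ_succ' (2 + d) 2]
    rfl
  simp only [p1, p2 1 le_rfl, p2 2 (by omega), p2 3 (by omega), p3, c1, c2, c3, c4, c5, c6, c7,
    c8] at t1 t2 t3 t4 t5 hN hR ⊢
  -- There are k = d + 1 Nédélec coefficients and 2 + (k - 1) = d + 2 Raviart–Thomas coefficients.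
  have hN' := Nat.mul_le_mul_left (d + 1) hN
  have hR' := Nat.mul_le_mul_left (d + 2) hR
  rw [show 2 + (d + 1 - 1) = d + 2 by omega]
  linarith

theorem dofs_surjective {k : ℕ} (hk : 1 ≤ k) : Function.Surjective (dofs k ∘ₗ ofCoeffs k) :=
  (LinearMap.injective_iff_surjective_of_finrank_eq_finrank (le_antisymm
    (LinearMap.finrank_le_finrank_of_injective (dofs_ofCoeffs_injective k)) (finrank_dofSpace_le hk))).1
    (dofs_ofCoeffs_injective k)
end TetPrism

/-! ### Unisolvence -/

theorem mainTheorem6 (k : ℕ) (hk : 1 ≤ k) :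
    (∀ F ∈ TetPrism.V2 k, TetPrism.DofsVanish k F → F = 0) ∧
    (∀ D : TetPrism.DofValues k, ∃! F : TetPrism.Field2,
      F ∈ TetPrism.V2 k ∧ TetPrism.HasDofs k F D) := by
  have hV : ∀ F ∈ TetPrism.V2 k, TetPrism.dofs k F = 0 → F = 0 := by
    intro F hF h
    rw [TetPrism.V2_eq_range hk] at hF
    obtain ⟨z, rfl⟩ := hF
    rw [(injective_iff_map_eq_zero _).1 (TetPrism.dofs_ofCoeffs_injective k) z h, map_zero]
  refine ⟨fun F hF h => hV F hF (TetPrism.dofs_eq_of_hasDofs h), fun D => ?_⟩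
  obtain ⟨z, hz⟩ := TetPrism.dofs_surjective hk
    (D.tri, D.quad, D.tet, D.prism1, D.prism2, D.vol1, D.vol2)
  have hmem : TetPrism.ofCoeffs k z ∈ TetPrism.V2 k := by
    rw [TetPrism.V2_eq_range hk]; exact ⟨z, rfl⟩
  refine ⟨TetPrism.ofCoeffs k z, ⟨hmem, TetPrism.hasDofs_of_dofs_eq hz⟩, ?_⟩
  rintro G ⟨hG, hG'⟩
  refine sub_eq_zero.1 (hV _ (Submodule.sub_mem _ hG hmem) ?_)
  rw [map_sub, TetPrism.dofs_eq_of_hasDofs hG', sub_eq_zero]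
  exact hz.symm
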